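/- Let $\mathcal H=\bigotimes_{k=1}^N\mathcal H_k$ ($N\ge 1$) be a tensor product of finite-dimensional Hilbert spaces (the target), and let $\mathcal P$ be a finite-dimensional Hilbert space (the incident/outgoing particle) with an orthonormal basis of outgoing states $|f\rangle$. For each $k$ let $T_k^{(1)}$ be an operator on $\mathcal P\otimes\mathcal H_k$, also regarded as an operator on $\mathcal P\otimes\mathcal H$ acting as the identity on every $\mathcal H_\ell$ with $\ell\ne k$. Let the S-matrix $S=S(\alpha)$ on $\mathcal P\otimes\mathcal H$ satisfy $$S=1+i\alpha\sum_{k=1}^N T_k^{(1)}+O(\alpha^2)\qquad(\alpha\to0),$$ and for each $k$ let $S_k=S_k(\alpha)=1+i\alpha T_k^{(1)}+O(\alpha^2)$ be an S-matrix on $\mathcal P\otimes\mathcal H_k$ for scattering from the $k$-th subsystem alone. Let $|i\rangle\in\mathcal P$ and $|t\rangle\in\mathcal H$ be unit vectors, $\rho=|t\rangle\langle t|$, $\Pi_\perp=1-|t\rangle\langle t|$, let $\rho_k$ be the reduced density matrix of $\rho$ on $\mathcal H_k$ and $s_k=-\operatorname{Tr}[\rho_k\ln\rho_k]$. The orthogonal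 scattering probabilities are $$p_\perp^{i\to f}=\langle i|\langle t|\,S^\dagger\big(|f\rangle\langle f|\otimes\Pi_\perp\big)S\,|i\rangle|t\rangle,\qquad p_\perp=\sum_f p_\perp^{i\to f},$$ and similarly for $S_k$ and pure states of $\mathcal H_k$. For a density matrix $\sigma$ on $\mathcal H_k$ one sets $p_\perp^{i\to f}(\sigma)=\operatorname{Var}_\sigma(\langle f|S_k|i\rangle)$, where $\operatorname{Var}_\sigma(G)=\operatorname{Tr}[\sigma G^\dagger G]-|\operatorname{Tr}[\sigma G]|^2$; for pure $\sigma$ this agrees with the previous formula. Let $p_{\perp,k}^{\max}$ denote either of the following single-subsystem maxima: (a) $\max_\sigma\sum_f p_\perp^{i\to f}(\sigma)$, over all density matrices $\sigma$ on $\mathcal H_k$; (b) $\sum_f p_{\perp,k}^{\max}(i\to f)$, where $p_{\perp,k}^{\max}(i\to f)$ is the maximum of $p_\perp^{i\to f}$ for $S_k$ over all pure states of $\mathcal H_k$. Then $p_\perp=c\,\alpha^2+O(\alpha^3)$ and $p_{\perp,k}^{\max}=m_k\,\alpha^2+O(\alpha^3)$ as $\alpha\to0$ for some real $c$ and $m_k$,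 and at order $\alpha^2$, for both (a) and (b), $$p_\perp\le \operatorname{Avg}_k\big(p_{\perp,k}^{\max}\big)\Big(N+2N^2\sqrt{\operatorname{Avg}_k(s_k)}\Big),$$ that is, $$c\le\Big(\tfrac1N\sum_{k=1}^N m_k\Big)\Big(N+2N^2\sqrt{\tfrac1N\sum_{k=1}^N s_k}\Big).$$ -/

import Mathlib

open Matrix Asymptotics Topology
open scoped Kronecker ComplexOrder

noncomputable section

/-! All Hilbert spaces are finite dimensional and are written in orthonormal bases: `φ` labels an
orthonormal basis of states of the incident/outgoing particle, `κ` one of a target, and `ι k` one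
of the `k`-th tensor factor, so that `∀ k, ι k` labels the product basis of the tensor product. -/

/-- A density matrix: positive semidefinite with trace one. -/
def IsDensity {κ : Type*} [Fintype κ] (ρ : Matrix κ κ ℂ) : Prop :=
  ρ.PosSemidef ∧ ρ.trace = 1

/-- The pure state `|t⟩⟨t|`. -/
def pureState {κ : Type*} (t : κ → ℂ) : Matrix κ κ ℂ :=
  vecMulVec t (star t)

/-- `Var_ρ(G) = Tr[ρ G† G] - |Tr[ρ G]|²`. -/
def opVariance {κ : Type*} [Fintype κ] (ρ G : Matrix κ κ ℂ) : ℝ :=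
  ((ρ * (Gᴴ * G)).trace).re - ‖(ρ * G).trace‖ ^ 2

/-- The von Neumann entropy `-Tr[ρ ln ρ]` (functional calculus, with `0 ln 0 = 0`). -/
def vonNeumannEntropy {κ : Type*} [Fintype κ] [DecidableEq κ] (ρ : Matrix κ κ ℂ) : ℝ :=
  -((ρ * cfc Real.log ρ).trace).re

/-- The reduced density matrix on the `k`-th factor: the trace over all other factors. -/
def reducedState {N : ℕ} {ι : Fin N → Type*} [∀ k, Fintype (ι k)] [∀ k, DecidableEq (ι k)]
    (k : Fin N) (ρ : Matrix (∀ l, ι l) (∀ l, ι l) ℂ) : Matrix (ι k) (ι k) ℂ :=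
  fun a b => ∑ x : ∀ l, ι l, if x k = a then ρ x (Function.update x k b) else 0

/-- An operator on (scattered particle) ⊗ (`k`-th factor), extended by the identity to all the
other factors. -/
def siteOp {N : ℕ} {ι : Fin N → Type*} [∀ k, DecidableEq (ι k)] {φ : Type*}
    (k : Fin N) (A : Matrix (φ × ι k) (φ × ι k) ℂ) :
    Matrix (φ × ∀ l, ι l) (φ × ∀ l, ι l) ℂ :=
  fun p q => if ∀ l, l ≠ k → p.2 l = q.2 l then A (p.1, p.2 k) (q.1, q.2 k) else 0

/-- `S = 1 + iαT + O(α²)` as `α → 0`. -/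
def HasFirstOrderTerm {n : Type*} [DecidableEq n] (S : ℝ → Matrix n n ℂ) (T : Matrix n n ℂ) :
    Prop :=
  ∀ p q, (fun α : ℝ => S α p q - (1 + (Complex.I * (α : ℂ)) • T) p q) =O[𝓝 0]
    fun α : ℝ => α ^ 2

section Scattering

variable {φ κ : Type*} [Fintype φ] [DecidableEq φ] [Fintype κ] [DecidableEq κ]

/-- The product vector `|i⟩|t⟩`. -/
def prodVec (i : φ → ℂ) (t : κ → ℂ) : φ × κ → ℂ :=
  fun p => i p.1 * t p.2

/-- The orthogonal scattering probability into the outgoing particle state `f`: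
`⟨i|⟨t| S† (|f⟩⟨f| ⊗ (1 - |t⟩⟨t|)) S |i⟩|t⟩`. -/
def orthProbTo (S : Matrix (φ × κ) (φ × κ) ℂ) (i : φ → ℂ) (f : φ) (t : κ → ℂ) : ℝ :=
  (star (prodVec i t) ⬝ᵥ
    ((Sᴴ * (Matrix.single f f (1 : ℂ) ⊗ₖ (1 - pureState t)) * S) *ᵥ prodVec i t)).re

/-- The total orthogonal scattering probability: the sum over outgoing particle states. -/
def orthProb (S : Matrix (φ × κ) (φ × κ) ℂ) (i : φ → ℂ) (t : κ → ℂ) : ℝ :=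
  ∑ f, orthProbTo S i f t

/-- The operator `⟨f|S|i⟩` on the target space. -/
def restrictOp (S : Matrix (φ × κ) (φ × κ) ℂ) (i : φ → ℂ) (f : φ) : Matrix κ κ ℂ :=
  fun x y => ∑ g, S (f, x) (g, y) * i g

/-- The orthogonal scattering probability into `f` of a possibly mixed target state; see
`orthProbToMixed_pureState` for pure states. For mixed `ρ` it is the orthogonal scattering
probability of any purification of `ρ`. -/
def orthProbToMixed (S : Matrix (φ × κ) (φ × κ) ℂ) (i : φ → ℂ) (f : φ) (ρ : Matrix κ κ ℂ) : ℝ :=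
  opVariance ρ (restrictOp S i f)

/-- The maximum over all states of the target of the total orthogonal scattering probability. -/
def maxOrthProb (S : Matrix (φ × κ) (φ × κ) ℂ) (i : φ → ℂ) : ℝ :=
  sSup {p : ℝ | ∃ ρ : Matrix κ κ ℂ, IsDensity ρ ∧ p = ∑ f, orthProbToMixed S i f ρ}

/-- The maximum over all pure states of the target of the orthogonal scattering probability into
the outgoing state `f`. -/
def maxOrthProbTo (S : Matrix (φ × κ) (φ × κ) ℂ) (i : φ → ℂ) (f : φ) : ℝ :=
  sSup {p : ℝ | ∃ t : κ → ℂ, star t ⬝ᵥ t = 1 ∧ p = orthProbTo S i f t}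

theorem orthProbToMixed_pureState (S : Matrix (φ × κ) (φ × κ) ℂ) (i : φ → ℂ) (f : φ)
    (t : κ → ℂ) :
    orthProbToMixed S i f (pureState t) = orthProbTo S i f t := by
  have h1 : ∀ G : Matrix κ κ ℂ, (pureState t * G).trace = star t ⬝ᵥ (G *ᵥ t) := by
    intro G
    rw [pureState, vecMulVec_mul, trace_vecMulVec, dotProduct_comm, dotProduct_mulVec]
  have h2 : ∀ x, (S *ᵥ prodVec i t) (f, x) = (restrictOp S i f *ᵥ t) x := by
    intro x
    simp only [mulVec, dotProduct, prodVec, restrictOp, Fintype.sum_prod_type, Finset.sum_mul]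
    rw [Finset.sum_comm]
    exact Finset.sum_congr rfl fun _ _ => Finset.sum_congr rfl fun _ _ => by ring
  set v := restrictOp S i f *ᵥ t with hv
  have h3 : star (prodVec i t) ⬝ᵥ
      ((Sᴴ * (Matrix.single f f (1 : ℂ) ⊗ₖ (1 - pureState t)) * S) *ᵥ prodVec i t)
      = star v ⬝ᵥ ((1 - pureState t) *ᵥ v) := by
    rw [Matrix.mul_assoc, ← mulVec_mulVec, dotProduct_mulVec, ← star_mulVec, ← mulVec_mulVec]
    set w := S *ᵥ prodVec i t with hw
    simp only [dotProduct, mulVec, kroneckerMap_apply, Fintype.sum_prod_type, Pi.star_apply,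
      Matrix.single_apply]
    rw [Finset.sum_eq_single f]
    · refine Finset.sum_congr rfl fun x _ => ?_
      rw [Finset.sum_eq_single f]
      · simp [h2]
      · intro b _ hb; simp [hb.symm]
      · simp
    · intro b _ hb; simp [hb.symm]
    · simp
  have h4 : star v ⬝ᵥ (pureState t *ᵥ v) = ((‖star t ⬝ᵥ v‖ ^ 2 : ℝ) : ℂ) := by
    rw [pureState, vecMulVec_mulVec]
    simp only [dotProduct_smul, MulOpposite.smul_eq_mul_unop, MulOpposite.unop_op]
    rw [show star v ⬝ᵥ t = star (star t ⬝ᵥ v) by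
      rw [star_dotProduct]]
    simpa using Complex.conj_mul' (star t ⬝ᵥ v)
  rw [orthProbTo, h3, orthProbToMixed, opVariance, h1, h1, sub_mulVec, dotProduct_sub, h4,
    one_mulVec, ← mulVec_mulVec, dotProduct_mulVec, ← star_mulVec, ← hv, Complex.sub_re,
    Complex.ofReal_re]

end Scattering

/-- The average over the `N` factors. -/
def avg {N : ℕ} (a : Fin N → ℝ) : ℝ :=
  (∑ k, a k) / N

end

/-! To first order ⟨f|S|i⟩ is a multiple of the identity plus iα Σ_k G_{k,f}, where G_{k,f} =
⟨f|T_k|i⟩ acts on the k-th factor. A variance does not see multiples of the identity, so p_⊥ is α²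
times the variance of Σ_k G_{k,f}, summed over f, up to an O(α³) that is uniform in the target state
(`exists_orthProbToMixed_expansion`). Uniformity carries the same expansion over to the single-site
suprema; in case (a), m_k is the largest summed variance of the G_{k,f}.

Expanding the variance of the sum gives covariances C_{kl}. Cauchy-Schwarz yields C_{kk} ≤ m_k. The
heart of the proof is |C_{kl}| ≤ 2 √s_k √(m_k m_l) for k ≠ l (`norm_vecCov_le_entropy`). If 2√s_k ≥
1, this is Cauchy-Schwarz again. Otherwise the largest eigenvalue p of ρ_k is close to one, and t =
ψ + r with ψ the dominant Schmidt term. A product state has no covariance between the factors, and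
the corrections due to r cost at most 2√(p(1-p)) + 4p(1-p) (`norm_vecCov_le_of_dominant`), which is
at most 2√s_k by elementary entropy bounds (`min_covariance_bound_le_sqrt`). Averaging over k and l
is `sum_le_avg_mul`.

Case (b) follows from (a), because the variance of a single operator in a mixed state is dominated
by its variance in some pure state (`IsDensity.exists_pure_opVariance_ge`). -/

noncomputable section

/-! ### Covariances of two commuting families of operators -/

section Covariance

variable {E : Type*} [NormedAddCommGroup E] [InnerProductSpace ℂ E] {φ : Type*} [Fintype φ]

/-- Cauchy-Schwarz for finite families of vectors. -/
theorem norm_sum_inner_le (x y : φ → E) :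
    ‖∑ f, inner ℂ (x f) (y f)‖ ≤ √(∑ f, ‖x f‖ ^ 2) * √(∑ f, ‖y f‖ ^ 2) :=
  (norm_sum_le _ _).trans <| (Finset.sum_le_sum fun _ _ => norm_inner_le_norm _ _).trans <|
    Real.sum_mul_le_sqrt_mul_sqrt _ _ _

/-- The variances of the family `A`, summed, are at most `M` in each mixture of two pure states. -/
def VarianceBound (A : φ → E →L[ℂ] E) (M : ℝ) : Prop :=
  ∀ x y : E, ∑ f, ((‖x‖ ^ 2 + ‖y‖ ^ 2) * (‖A f x‖ ^ 2 + ‖A f y‖ ^ 2)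
    - ‖inner ℂ x (A f x) + inner ℂ y (A f y)‖ ^ 2) ≤ M * (‖x‖ ^ 2 + ‖y‖ ^ 2) ^ 2

/-- The sum over the families of the covariances in the vector state `t`. -/
def vecCov (A B : φ → E →L[ℂ] E) (t : E) : ℂ :=
  ∑ f, (inner ℂ (A f t) (B f t) - inner ℂ (A f t) t * inner ℂ t (B f t))

theorem inner_sub_smul_eq_zero {x y : E} {a : ℂ} (h : inner ℂ x y = a * ‖x‖ ^ 2) :
    inner ℂ x (y - a • x) = 0 := by
  rw [inner_sub_right, inner_smul_right, inner_self_eq_norm_sq_to_K, h]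
  simp

theorem norm_sub_smul_sq {x y : E} {a : ℂ} (h : inner ℂ x y = a * ‖x‖ ^ 2) :
    ‖y - a • x‖ ^ 2 = ‖y‖ ^ 2 - ‖a‖ ^ 2 * ‖x‖ ^ 2 := by
  have h0 := inner_sub_smul_eq_zero h
  have h1 : ‖(y - a • x) + a • x‖ ^ 2 = ‖y - a • x‖ ^ 2 + ‖a • x‖ ^ 2 := by
    rw [sq, sq, sq]
    refine norm_add_sq_eq_norm_sq_add_norm_sq_of_inner_eq_zero (𝕜 := ℂ) _ _ ?_
    rw [inner_smul_right, ← inner_conj_symm, h0]; simp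
  rw [sub_add_cancel, norm_smul, mul_pow] at h1
  linarith

/-- Stated without division so that the remainder r of the Schmidt splitting, which vanishes for
product states, needs no separate treatment. -/
theorem exists_expectation (A : E →L[ℂ] E) (x : E) :
    ∃ a : ℂ, inner ℂ x (A x) = a * ‖x‖ ^ 2 := by
  by_cases hx : x = 0
  · exact ⟨0, by simp [hx]⟩
  · refine ⟨inner ℂ x (A x) / ‖x‖ ^ 2, ?_⟩
    have : (‖x‖ : ℂ) ≠ 0 := by simpa using hx
    field_simp

/-- This is the pure case of the bound, with second vector zero, rescaled to a vector of any norm.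
-/
theorem VarianceBound.sum_sub_smul_le {A : φ → E →L[ℂ] E} {M : ℝ} (hA : VarianceBound A M)
    {x : E} {a : φ → ℂ} (ha : ∀ f, inner ℂ x (A f x) = a f * ‖x‖ ^ 2) :
    ∑ f, ‖A f x - a f • x‖ ^ 2 ≤ M * ‖x‖ ^ 2 := by
  by_cases hx : x = 0
  · simp [hx]
  have hx' : 0 < ‖x‖ ^ 2 := by positivity
  have h := hA x 0
  simp only [map_zero, norm_zero, ne_eq, OfNat.ofNat_ne_zero, not_false_eq_true, zero_pow, add_zero,
    inner_zero_left] at h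
  refine le_of_mul_le_mul_left ?_ hx'
  calc ‖x‖ ^ 2 * ∑ f, ‖A f x - a f • x‖ ^ 2
      = ∑ f, (‖x‖ ^ 2 * ‖A f x‖ ^ 2 - ‖inner ℂ x (A f x)‖ ^ 2) := by
        rw [Finset.mul_sum]
        refine Finset.sum_congr rfl fun f _ => ?_
        rw [norm_sub_smul_sq (ha f), ha f]
        simp only [norm_mul, norm_pow, Complex.norm_real, norm_norm]
        ring
    _ ≤ M * (‖x‖ ^ 2) ^ 2 := h
    _ = ‖x‖ ^ 2 * (M * ‖x‖ ^ 2) := by ring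

theorem VarianceBound.nonneg {A : φ → E →L[ℂ] E} {M : ℝ} (hA : VarianceBound A M)
    {x : E} (hx : ‖x‖ = 1) : 0 ≤ M := by
  choose a ha using fun f => exists_expectation (A f) x
  have := hA.sum_sub_smul_le ha
  rw [hx, one_pow, mul_one] at this
  exact (Finset.sum_nonneg fun _ _ => by positivity).trans this

/-- Covariances do not change when multiples of the identity are subtracted. -/
theorem vecCov_eq_shift (A B : φ → E →L[ℂ] E) {t : E} (ht : ‖t‖ = 1) (a b : φ → ℂ) :
    vecCov A B t = ∑ f, (inner ℂ (A f t - a f • t) (B f t - b f • t)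
      - inner ℂ (A f t - a f • t) t * inner ℂ t (B f t - b f • t)) := by
  refine Finset.sum_congr rfl fun f _ => ?_
  have h1 : inner ℂ t t = (1 : ℂ) := by rw [inner_self_eq_norm_sq_to_K, ht]; simp
  simp only [inner_sub_left, inner_sub_right, inner_smul_left, inner_smul_right, h1]
  ring

/-- After subtracting expectation values the covariance is a sum of inner products, and
Cauchy-Schwarz applies. No commutation is needed. -/
theorem norm_vecCov_le {A B : φ → E →L[ℂ] E} {MA MB : ℝ} (hA : VarianceBound A MA)
    (hB : VarianceBound B MB) {t : E} (ht : ‖t‖ = 1) :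
    ‖vecCov A B t‖ ≤ √MA * √MB := by
  choose a ha using fun f => exists_expectation (A f) t
  choose b hb using fun f => exists_expectation (B f) t
  rw [vecCov_eq_shift A B ht a b]
  simp only [inner_sub_smul_eq_zero (hb _), mul_zero, sub_zero]
  refine (norm_sum_inner_le _ _).trans ?_
  have h1 := hA.sum_sub_smul_le ha
  have h2 := hB.sum_sub_smul_le hb
  rw [ht, one_pow, mul_one] at h1 h2
  gcongr

/-- The expectation values of two pure states are close if all variances are small. -/
theorem VarianceBound.two_mul_add_le {A : φ → E →L[ℂ] E} {M : ℝ} (hA : VarianceBound A M)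
    {x y : E} (hx : 0 < ‖x‖) {a b : φ → ℂ}
    (ha : ∀ f, inner ℂ x (A f x) = a f * ‖x‖ ^ 2)
    (hb : ∀ f, inner ℂ y (A f y) = b f * ‖y‖ ^ 2) :
    2 * ∑ f, ‖A f y - b f • y‖ ^ 2 + ‖y‖ ^ 2 * ∑ f, ‖b f - a f‖ ^ 2 ≤ 4 * ‖y‖ ^ 2 * M := by
  by_cases hy : y = 0
  · simp [hy]
  have hy' : 0 < ‖y‖ := norm_pos_iff.2 hy
  -- Rescaling to a common norm gives an equal mixture. Its variance is the mean of the two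
  -- variances plus |b - a|²/4, by the parallelogram law; the variance in `x` is then dropped.
  have h := hA ((‖y‖ : ℂ) • x) ((‖x‖ : ℂ) • y)
  have key : ∀ f, 2 * ‖x‖ ^ 4 * ‖y‖ ^ 2 * ‖A f y - b f • y‖ ^ 2
      + ‖x‖ ^ 4 * ‖y‖ ^ 4 * ‖b f - a f‖ ^ 2 ≤
      ((‖(‖y‖ : ℂ) • x‖ ^ 2 + ‖(‖x‖ : ℂ) • y‖ ^ 2) *
        (‖A f ((‖y‖ : ℂ) • x)‖ ^ 2 + ‖A f ((‖x‖ : ℂ) • y)‖ ^ 2)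
      - ‖inner ℂ ((‖y‖ : ℂ) • x) (A f ((‖y‖ : ℂ) • x))
        + inner ℂ ((‖x‖ : ℂ) • y) (A f ((‖x‖ : ℂ) • y))‖ ^ 2) := by
    intro f
    have e1 := norm_sub_smul_sq (ha f)
    have e2 := norm_sub_smul_sq (hb f)
    have e3 : inner ℂ ((‖y‖ : ℂ) • x) (A f ((‖y‖ : ℂ) • x))
        + inner ℂ ((‖x‖ : ℂ) • y) (A f ((‖x‖ : ℂ) • y))
        = ((‖x‖ ^ 2 * ‖y‖ ^ 2 : ℝ) : ℂ) * (a f + b f) := by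
      simp only [map_smul, inner_smul_left, inner_smul_right, ha, hb, Complex.conj_ofReal]
      push_cast; ring
    have e4 : ‖b f - a f‖ ^ 2 = 2 * ‖a f‖ ^ 2 + 2 * ‖b f‖ ^ 2 - ‖a f + b f‖ ^ 2 := by
      have := parallelogram_law_with_norm ℝ (a f) (b f)
      rw [norm_sub_rev]; linarith [sq ‖a f - b f‖, sq ‖a f + b f‖, sq ‖a f‖, sq ‖b f‖]
    rw [e3]
    simp only [map_smul, norm_smul, norm_mul, Complex.norm_real, Real.norm_eq_abs,
      abs_pow, abs_norm]
    rw [e4]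
    have e5 : ‖A f x‖ ^ 2 = ‖A f x - a f • x‖ ^ 2 + ‖a f‖ ^ 2 * ‖x‖ ^ 2 := by linarith
    have e6 : ‖A f y‖ ^ 2 = ‖A f y - b f • y‖ ^ 2 + ‖b f‖ ^ 2 * ‖y‖ ^ 2 := by linarith
    simp only [mul_pow]
    rw [e5, e6]
    have : 0 ≤ 2 * ‖x‖ ^ 2 * ‖y‖ ^ 4 * ‖A f x - a f • x‖ ^ 2 := by positivity
    linarith
  have h2 := (Finset.sum_le_sum fun f (_ : f ∈ Finset.univ) => key f).trans h
  rw [Finset.sum_add_distrib, ← Finset.mul_sum, ← Finset.mul_sum] at h2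
  have h3 : 0 < ‖x‖ ^ 4 * ‖y‖ ^ 2 := by positivity
  refine le_of_mul_le_mul_left ?_ h3
  simp only [norm_smul, Complex.norm_real, norm_norm] at h2
  linarith

theorem sqrt_mul_add_sqrt_mul_le {a b c d : ℝ} (ha : 0 ≤ a) (hb : 0 ≤ b) (hc : 0 ≤ c)
    (hd : 0 ≤ d) : √a * √b + √c * √d ≤ √(a + c) * √(b + d) := by
  rw [← Real.sqrt_mul (add_nonneg ha hc) (b + d)]
  apply Real.le_sqrt_of_sq_le
  have h1 := Real.sq_sqrt ha
  have h2 := Real.sq_sqrt hb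
  have h3 := Real.sq_sqrt hc
  have h4 := Real.sq_sqrt hd
  nlinarith [sq_nonneg (√a * √d - √b * √c)]

/-- Multiply `dA` and `dB` by `p`; since 1 ≤ 2p, the variance terms keep coefficient at least one.
Cauchy-Schwarz in the plane then bounds both products together, where separate estimates would lose
a constant. -/
theorem sqrt_combination_le {p MA MB VA VB DA DB : ℝ} (hp : 1 / 2 ≤ p) (hε : 0 ≤ 1 - p)
    (hVA : 0 ≤ VA) (hVB : 0 ≤ VB) (hDA : 0 ≤ DA) (hDB : 0 ≤ DB)
    (dA : 2 * VA + (1 - p) * DA ≤ 4 * (1 - p) * MA)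
    (dB : 2 * VB + (1 - p) * DB ≤ 4 * (1 - p) * MB) :
    √VA * √VB + p * (1 - p) * (√DA * √DB) ≤ 4 * (p * (1 - p)) * (√MA * √MB) := by
  have hp0 : 0 ≤ p := by linarith
  have hpe : 0 ≤ p * (1 - p) := mul_nonneg hp0 hε
  have kA : VA + p * (1 - p) * DA ≤ 4 * (p * (1 - p)) * MA := by
    nlinarith [mul_nonneg hVA (by linarith : 0 ≤ 2 * p - 1), mul_le_mul_of_nonneg_left dA hp0]
  have kB : VB + p * (1 - p) * DB ≤ 4 * (p * (1 - p)) * MB := by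
    nlinarith [mul_nonneg hVB (by linarith : 0 ≤ 2 * p - 1), mul_le_mul_of_nonneg_left dB hp0]
  have h4 : 0 ≤ 4 * (p * (1 - p)) := by linarith
  have e1 : p * (1 - p) * (√DA * √DB) = √(p * (1 - p) * DA) * √(p * (1 - p) * DB) := by
    rw [Real.sqrt_mul hpe, Real.sqrt_mul hpe, mul_mul_mul_comm √(p * (1 - p)), Real.mul_self_sqrt hpe]
  have e2 : 4 * (p * (1 - p)) * (√MA * √MB)
      = √(4 * (p * (1 - p)) * MA) * √(4 * (p * (1 - p)) * MB) := by
    rw [Real.sqrt_mul h4, Real.sqrt_mul h4, mul_mul_mul_comm √(4 * (p * (1 - p))), Real.mul_self_sqrt h4]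
  rw [e1, e2]
  refine (sqrt_mul_add_sqrt_mul_le hVA hVB (mul_nonneg hpe hDA) (mul_nonneg hpe hDB)).trans ?_
  exact mul_le_mul (Real.sqrt_le_sqrt kA) (Real.sqrt_le_sqrt kB) (Real.sqrt_nonneg _)
    (Real.sqrt_nonneg _)

theorem norm_starProjection_apply_le [CompleteSpace E] {Q : E →L[ℂ] E} (hQ : IsStarProjection Q)
    (x : E) : ‖Q x‖ ≤ ‖x‖ := by
  have h1 : inner ℂ (Q x) (Q x) = inner ℂ x (Q x) := by
    rw [show inner ℂ (Q x) (Q x) = inner ℂ x (Q (Q x)) from hQ.isSelfAdjoint.isSymmetric x (Q x)]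
    exact congrArg _ (by simpa using congrArg (fun T : E →L[ℂ] E => T x) hQ.isIdempotentElem)
  have h2 := norm_inner_le_norm (𝕜 := ℂ) x (Q x)
  rw [← h1, inner_self_eq_norm_sq_to_K] at h2
  simp only [norm_pow, Complex.coe_algebraMap, Complex.norm_real, norm_norm] at h2
  by_contra hc
  push Not at hc
  nlinarith [norm_nonneg x]

set_option maxHeartbeats 400000 in
/-- Covariance of two commuting families in a state close to a product state. Here `P` and `W`
project onto the two factors of the dominant product state `ψ` of `t`. -/
theorem norm_vecCov_le_of_dominant [CompleteSpace E] {A B : φ → E →L[ℂ] E} {MA MB : ℝ}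
    (hA : VarianceBound A MA) (hB : VarianceBound B MB) {t ψ : E} (ht : ‖t‖ = 1)
    {P W : E →L[ℂ] E} (hP : IsStarProjection P) (hW : IsStarProjection W)
    (hPt : P t = ψ) (hWt : W t = ψ) (hAW : ∀ f, Commute W (A f)) (hBP : ∀ f, Commute P (B f))
    (hPW : ∀ x, inner ℂ ψ x = 0 → P (W x) = 0) {p : ℝ} (hp : ‖ψ‖ ^ 2 = p) (hp2 : 1 / 2 ≤ p) :
    ‖vecCov A B t‖ ≤ (2 * √(p * (1 - p)) + 4 * (p * (1 - p))) * (√MA * √MB) := by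
  set r := t - ψ with hr
  have selfadj : ∀ {Q : E →L[ℂ] E}, IsStarProjection Q → ∀ x y, inner ℂ (Q x) y = inner ℂ x (Q y) :=
    fun hQ x y => hQ.isSelfAdjoint.isSymmetric x y
  have idem : ∀ {Q : E →L[ℂ] E}, IsStarProjection Q → ∀ x, Q (Q x) = Q x := fun hQ x => by
    simpa using congrArg (fun T : E →L[ℂ] E => T x) hQ.isIdempotentElem
  have hPψ : P ψ = ψ := by rw [← hPt, idem hP]
  have hWψ : W ψ = ψ := by rw [← hWt, idem hW]
  have hPr : P r = 0 := by rw [hr, map_sub, hPt, hPψ, sub_self]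
  have hWr : W r = 0 := by rw [hr, map_sub, hWt, hWψ, sub_self]
  have htr : t = ψ + r := by rw [hr]; abel
  have hψr : inner ℂ ψ r = (0 : ℂ) := by rw [← hPψ, selfadj hP, hPr, inner_zero_right]
  have hrψ : inner ℂ r ψ = (0 : ℂ) := by rw [← inner_conj_symm, hψr, map_zero]
  have hrn : ‖r‖ ^ 2 = 1 - p := by
    have := norm_add_sq_eq_norm_sq_add_norm_sq_of_inner_eq_zero (𝕜 := ℂ) _ _ hψr
    rw [← htr, ht] at this
    rw [← hp]; linarith
  have hψ0 : 0 < ‖ψ‖ := by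
    rcases (norm_nonneg ψ).eq_or_lt with h | h
    · rw [← h] at hp; norm_num at hp; linarith
    · exact h
  have hε : 0 ≤ 1 - p := by rw [← hrn]; positivity
  have hMA := hA.nonneg ht
  have hMB := hB.nonneg ht
  have comm : ∀ {Q T : E →L[ℂ] E}, Commute Q T → ∀ x, Q (T x) = T (Q x) := fun h x => by
    simpa using congrArg (fun T : E →L[ℂ] E => T x) h.eq
  choose a ha using fun f => exists_expectation (A f) ψ
  choose b hb using fun f => exists_expectation (B f) ψ
  choose α hα using fun f => exists_expectation (A f) r
  choose β hβ using fun f => exists_expectation (B f) r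
  -- Shift by the expectations in ψ and split t = ψ + r on both sides. Most cross terms vanish: `A`
  -- preserves the range and kernel of `W`, `B` those of `P`, and r lies in both kernels.
  have hterm : ∀ f, (inner ℂ (A f t - a f • t) (B f t - b f • t)
      - inner ℂ (A f t - a f • t) t * inner ℂ t (B f t - b f • t))
      = inner ℂ (A f ψ - a f • ψ) (W (B f r - β f • r))
        + inner ℂ (P (A f r - α f • r)) (B f ψ - b f • ψ)
        + (inner ℂ (A f r - α f • r) (B f r - β f • r)
        + ((p * (1 - p) : ℝ) : ℂ) * inner ℂ (α f - a f) (β f - b f)) := by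
    intro f
    have eA : A f t - a f • t = (A f ψ - a f • ψ) + ((A f r - α f • r) + (α f - a f) • r) := by
      rw [htr, map_add]; module
    have eB : B f t - b f • t = (B f ψ - b f • ψ) + ((B f r - β f • r) + (β f - b f) • r) := by
      rw [htr, map_add]; module
    have z1 := inner_sub_smul_eq_zero (ha f)
    have z2 := inner_sub_smul_eq_zero (hb f)
    have z3 := inner_sub_smul_eq_zero (hα f)
    have z4 := inner_sub_smul_eq_zero (hβ f)
    have z1' : inner ℂ (A f ψ - a f • ψ) ψ = (0 : ℂ) := by rw [← inner_conj_symm, z1, map_zero]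
    have z3' : inner ℂ (A f r - α f • r) r = (0 : ℂ) := by rw [← inner_conj_symm, z3, map_zero]
    have wA : W (A f ψ - a f • ψ) = A f ψ - a f • ψ := by
      rw [map_sub, map_smul, comm (hAW f), hWψ]
    have pB : P (B f ψ - b f • ψ) = B f ψ - b f • ψ := by
      rw [map_sub, map_smul, comm (hBP f), hPψ]
    have wA2 : W (A f r - α f • r) = 0 := by
      rw [map_sub, map_smul, comm (hAW f), hWr]; simp
    have pB2 : P (B f r - β f • r) = 0 := by
      rw [map_sub, map_smul, comm (hBP f), hPr]; simp
    set X := A f ψ - a f • ψ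
    set Y := B f ψ - b f • ψ
    set X' := A f r - α f • r
    set Y' := B f r - β f • r
    -- The product state itself has no covariance: `X` is in the range of `W` and orthogonal to ψ,
    -- so `hPW` makes `P` kill it, while `Y` is in the range of `P`.
    have c1 : inner ℂ X Y = (0 : ℂ) := by
      rw [← pB, ← selfadj hP, ← wA, hPW X z1, inner_zero_left]
    have c2 : inner ℂ X Y' = inner ℂ X (W Y') := by rw [← selfadj hW, wA]
    have c3 : inner ℂ X' Y = inner ℂ (P X') Y := by rw [selfadj hP, pB]
    have c4 : inner ℂ X r = (0 : ℂ) := by rw [← wA, selfadj hW, hWr, inner_zero_right]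
    have c5 : inner ℂ r Y = (0 : ℂ) := by rw [← pB, ← selfadj hP, hPr, inner_zero_left]
    have c6 : inner ℂ X' ψ = (0 : ℂ) := by rw [← hWψ, ← selfadj hW, wA2, inner_zero_left]
    have c7 : inner ℂ ψ Y' = (0 : ℂ) := by rw [← hPψ, selfadj hP, pB2, inner_zero_right]
    have hrr : inner ℂ r r = ((1 - p : ℝ) : ℂ) := by
      rw [inner_self_eq_norm_sq_to_K, ← hrn]; push_cast; rfl
    rw [eA, eB, htr]
    simp only [inner_add_left, inner_add_right, inner_smul_left, inner_smul_right, c1, ← c2, ← c3,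
      c4, c5, c6, c7, z1', z2, z3', z4, hrψ, hψr, hrr, mul_zero, zero_add, add_zero,
      RCLike.inner_apply]
    push_cast
    ring
  rw [vecCov_eq_shift A B ht a b, Finset.sum_congr rfl fun f _ => hterm f]
  simp only [Finset.sum_add_distrib, ← Finset.mul_sum]
  have uA := hA.sum_sub_smul_le ha
  have uB := hB.sum_sub_smul_le hb
  have vA := hA.sum_sub_smul_le hα
  have vB := hB.sum_sub_smul_le hβ
  have dA := hA.two_mul_add_le hψ0 ha hα
  have dB := hB.two_mul_add_le hψ0 hb hβ
  rw [hp] at uA uB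
  rw [hrn] at vA vB dA dB
  have b1 := norm_sum_inner_le (fun f => A f ψ - a f • ψ) (fun f => W (B f r - β f • r))
  have b2 := norm_sum_inner_le (fun f => P (A f r - α f • r)) (fun f => B f ψ - b f • ψ)
  have b3 := norm_sum_inner_le (fun f => A f r - α f • r) (fun f => B f r - β f • r)
  have b4 := norm_sum_inner_le (fun f => α f - a f) (fun f => β f - b f)
  have w1 : ∑ f, ‖W (B f r - β f • r)‖ ^ 2 ≤ MB * (1 - p) :=
    (Finset.sum_le_sum fun f _ => by gcongr; exact norm_starProjection_apply_le hW _).trans vB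
  have w2 : ∑ f, ‖P (A f r - α f • r)‖ ^ 2 ≤ MA * (1 - p) :=
    (Finset.sum_le_sum fun f _ => by gcongr; exact norm_starProjection_apply_le hP _).trans vA
  have s1 : √(MA * p) * √(MB * (1 - p)) = √(p * (1 - p)) * (√MA * √MB) := by
    rw [Real.sqrt_mul hMA, Real.sqrt_mul hMB, Real.sqrt_mul (by linarith)]; ring
  have s2 : √(MA * (1 - p)) * √(MB * p) = √(p * (1 - p)) * (√MA * √MB) := by
    rw [Real.sqrt_mul hMA, Real.sqrt_mul hMB, Real.sqrt_mul (by linarith)]; ring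
  have t1 := b1.trans (mul_le_mul (Real.sqrt_le_sqrt uA) (Real.sqrt_le_sqrt w1) (by positivity)
    (by positivity))
  have t2 := b2.trans (mul_le_mul (Real.sqrt_le_sqrt w2) (Real.sqrt_le_sqrt uB) (by positivity)
    (by positivity))
  rw [s1] at t1
  rw [s2] at t2
  set VA := ∑ f, ‖A f r - α f • r‖ ^ 2
  set VB := ∑ f, ‖B f r - β f • r‖ ^ 2
  set DA := ∑ f, ‖α f - a f‖ ^ 2
  set DB := ∑ f, ‖β f - b f‖ ^ 2
  have hVA : 0 ≤ VA := Finset.sum_nonneg fun _ _ => by positivity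
  have hVB : 0 ≤ VB := Finset.sum_nonneg fun _ _ => by positivity
  have hDA : 0 ≤ DA := Finset.sum_nonneg fun _ _ => by positivity
  have hDB : 0 ≤ DB := Finset.sum_nonneg fun _ _ => by positivity
  have hpe : 0 ≤ p * (1 - p) := mul_nonneg (by linarith) hε
  have t3 := sqrt_combination_le hp2 hε hVA hVB hDA hDB dA dB
  have t4 : ‖((p * (1 - p) : ℝ) : ℂ) * ∑ f, inner ℂ (α f - a f) (β f - b f)‖
      ≤ p * (1 - p) * (√DA * √DB) := by
    rw [norm_mul, Complex.norm_real, Real.norm_of_nonneg hpe]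
    exact mul_le_mul_of_nonneg_left b4 hpe
  refine (norm_add_le _ _).trans ((add_le_add (norm_add_le _ _) (norm_add_le _ _)).trans ?_)
  linarith

end Covariance

/-! ### The dominant Schmidt term without an explicit tensor splitting -/

section Schmidt

theorem ketBra_mul_ketBra {κ : Type*} [Fintype κ] (a b c d : κ → ℂ) :
    vecMulVec a (star b) * vecMulVec c (star d) = (star b ⬝ᵥ c) • vecMulVec a (star d) := by
  rw [vecMulVec_mul_vecMulVec]
  ext i j
  simp [vecMulVec_apply]
  ring

variable {E : Type*} [NormedAddCommGroup E] [InnerProductSpace ℂ E] [CompleteSpace E]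
  {κ : Type*} [Fintype κ] [DecidableEq κ]

theorem inner_starAlgHom_apply (π : Matrix κ κ ℂ →⋆ₐ[ℂ] (E →L[ℂ] E)) (G : Matrix κ κ ℂ) (x y : E) :
    inner ℂ x (π G y) = inner ℂ (π Gᴴ x) y := by
  rw [← star_eq_conjTranspose, map_star, ContinuousLinearMap.star_eq_adjoint,
    ContinuousLinearMap.adjoint_inner_left]

theorem starAlgHom_mul_apply (π : Matrix κ κ ℂ →⋆ₐ[ℂ] (E →L[ℂ] E)) (F G : Matrix κ κ ℂ) (x : E) :
    π F (π G x) = π (F * G) x := by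
  rw [map_mul]; rfl

theorem mul_vecMulVec_single (G : Matrix κ κ ℂ) (a : κ) (u : κ → ℂ) :
    G * vecMulVec (Pi.single a 1) (star u)
      = ∑ b, G b a • vecMulVec (Pi.single b 1) (star u) := by
  ext i j
  rw [mul_vecMulVec, Matrix.sum_apply]
  simp [vecMulVec_apply, Pi.single_apply]

/-- If the eigenvector `u` of the marginal `ρ` of the vector state `t` has eigenvalue `p > 0`, then
`|u⟩⟨u| t` is also obtained by a projection that commutes with the operators on the subsystem. -/
theorem exists_complementary_projection (π : Matrix κ κ ℂ →⋆ₐ[ℂ] (E →L[ℂ] E)) {t : E}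
    {ρ : Matrix κ κ ℂ} (hρ : ∀ G, inner ℂ t (π G t) = (ρ * G).trace) {u : κ → ℂ}
    (hu : star u ⬝ᵥ u = 1) {p : ℝ} (hp : 0 < p) (hpu : ρ *ᵥ u = (p : ℂ) • u) :
    ∃ W : E →L[ℂ] E, IsStarProjection W ∧ W t = π (vecMulVec u (star u)) t ∧
      (∀ G, Commute W (π G)) ∧ ‖π (vecMulVec u (star u)) t‖ ^ 2 = p ∧
      ∀ x, inner ℂ (π (vecMulVec u (star u)) t) x = 0 → π (vecMulVec u (star u)) (W x) = 0 := by
  have hp' : (p : ℂ) ≠ 0 := by exact_mod_cast hp.ne'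
  have hstar : ∀ a b : κ → ℂ, (vecMulVec a (star b))ᴴ = vecMulVec b (star a) := fun a b => by
    rw [conjTranspose_vecMulVec, star_star]
  have htr : ∀ a : κ → ℂ, (ρ * vecMulVec u (star a)).trace = p * (star a ⬝ᵥ u) := fun a => by
    rw [mul_vecMulVec, hpu, trace_vecMulVec, smul_dotProduct, dotProduct_comm, smul_eq_mul]
  set ψ := π (vecMulVec u (star u)) t with hψ
  have hψψ : π (vecMulVec u (star u)) ψ = ψ := by
    rw [hψ, starAlgHom_mul_apply, ketBra_mul_ketBra, hu, one_smul]
  have hin : inner ℂ ψ ψ = (p : ℂ) := by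
    nth_rw 1 [hψ]
    rw [show vecMulVec u (star u) = (vecMulVec u (star u))ᴴ by rw [hstar],
      ← inner_starAlgHom_apply, hψψ, hψ, hρ, htr, hu, mul_one]
  -- With ψ = √p u ⊗ v these are the vectors √p e_a ⊗ v. Their span is invariant under every `π G`,
  -- which is why the projection onto it commutes with the subsystem.
  set η : κ → E := fun a => π (vecMulVec (Pi.single a 1) (star u)) ψ with hη
  have hη1 : ∀ a x, inner ℂ (η a) x = inner ℂ ψ (π (vecMulVec u (star (Pi.single a 1))) x) := by
    intro a x
    rw [inner_starAlgHom_apply, hstar]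
  have horth : ∀ a b, inner ℂ (η a) (η b) = if a = b then (p : ℂ) else 0 := by
    intro a b
    rw [hη1, hη, starAlgHom_mul_apply, ketBra_mul_ketBra, map_smul, _root_.smul_apply,
      hψψ, inner_smul_right, hin]
    simp [Pi.single_apply, eq_comm]
  have hsum : ∑ a, u a • η a = ψ := by
    conv_rhs => rw [← hψψ]
    simp only [hη, ← _root_.smul_apply, ← map_smul, ← _root_.sum_apply,
      ← map_sum]
    congr 2
    ext i j
    simp [Matrix.sum_apply, vecMulVec_apply, Pi.single_apply]
  have hηG : ∀ G a, π G (η a) = ∑ b, G b a • η b := by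
    intro G a
    simp only [hη]
    rw [starAlgHom_mul_apply, mul_vecMulVec_single, map_sum, _root_.sum_apply]
    simp only [map_smul, _root_.smul_apply]
  have hηt : ∀ a, inner ℂ (η a) t = p * u a := by
    intro a
    rw [hη1, hψ, show vecMulVec u (star u) = (vecMulVec u (star u))ᴴ by rw [hstar],
      ← inner_starAlgHom_apply, starAlgHom_mul_apply, ketBra_mul_ketBra, hu, one_smul, hρ, htr]
    simp
  -- The orthogonal projection onto the span of the `η a`; the factor 1/p compensates ‖η a‖² = p.
  set W : E →L[ℂ] E := (p : ℂ)⁻¹ • ∑ a, (innerSL ℂ (η a)).smulRight (η a) with hW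
  have hWx : ∀ x, W x = (p : ℂ)⁻¹ • ∑ a, inner ℂ (η a) x • η a := by
    intro x
    simp [hW]
  have hWη : ∀ b, W (η b) = η b := by
    intro b
    rw [hWx]
    simp only [horth, ite_smul, zero_smul, Finset.sum_ite_eq', Finset.mem_univ, if_true]
    rw [smul_smul, inv_mul_cancel₀ hp', one_smul]
  refine ⟨W, ⟨?_, ?_⟩, ?_, ?_, ?_, ?_⟩
  · ext x
    change W (W x) = W x
    conv_lhs => rw [hWx x]
    rw [map_smul, map_sum]
    simp only [map_smul, hWη]
    rw [hWx]
  · rw [ContinuousLinearMap.isSelfAdjoint_iff_isSymmetric]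
    intro x y
    change inner ℂ (W x) y = inner ℂ x (W y)
    simp only [hWx, inner_smul_left, inner_smul_right, sum_inner, inner_sum, inner_conj_symm,
      map_inv₀, Complex.conj_ofReal]
    congr 1
    exact Finset.sum_congr rfl fun a _ => mul_comm _ _
  · rw [hWx]
    simp only [hηt, mul_smul, ← Finset.smul_sum, hsum]
    rw [smul_smul, inv_mul_cancel₀ hp', one_smul]
  · intro G
    ext x
    change W (π G x) = π G (W x)
    rw [hWx, hWx, map_smul, map_sum]
    congr 1
    simp only [inner_starAlgHom_apply, hηG, map_smul, sum_inner, inner_smul_left,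
      conjTranspose_apply, starRingEnd_apply, star_star, Finset.sum_smul, Finset.smul_sum, smul_smul]
    rw [Finset.sum_comm]
    exact Finset.sum_congr rfl fun a _ => Finset.sum_congr rfl fun b _ => by rw [mul_comm]
  · have := inner_self_eq_norm_sq_to_K (𝕜 := ℂ) ψ
    rw [hin] at this
    exact Complex.ofReal_injective (by simpa using this.symm)
  · intro x hx
    have h1 : ∀ a, π (vecMulVec u (star u)) (η a) = star (u a) • ψ := by
      intro a
      simp only [hη]
      rw [starAlgHom_mul_apply, ketBra_mul_ketBra, map_smul, _root_.smul_apply, hψψ]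
      simp
    rw [hWx, map_smul, map_sum]
    simp only [map_smul, h1, smul_smul, ← Finset.sum_smul]
    have h2 : ∑ a, inner ℂ (η a) x * star (u a) = inner ℂ ψ x := by
      rw [← hsum]
      simp only [sum_inner, inner_smul_left]
      exact Finset.sum_congr rfl fun a _ => mul_comm _ _
    rw [h2, hx, mul_zero, zero_smul]

end Schmidt

/-! ### Entropy bounds in terms of the largest eigenvalue -/

section Entropy

variable {κ : Type*} [Fintype κ] [DecidableEq κ]

theorem vonNeumannEntropy_eq_sum {ρ : Matrix κ κ ℂ} (hρ : ρ.IsHermitian) :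
    vonNeumannEntropy ρ = ∑ i, hρ.eigenvalues i * -Real.log (hρ.eigenvalues i) := by
  have h1 : ρ * cfc Real.log ρ = cfc (fun x => x * Real.log x) ρ := by
    -- The logarithm is discontinuous at 0, but the spectrum is finite, hence discrete, and every
    -- function is continuous on it.
    rw [cfc_mul (fun x => x) Real.log ρ (by fun_prop) (by
      rw [continuousOn_iff_continuous_domRestrict]
      exact continuous_of_discreteTopology), cfc_id' ℝ ρ]
  rw [vonNeumannEntropy, h1, hρ.cfc_eq, IsHermitian.cfc, Unitary.conjStarAlgAut_apply,
    trace_mul_cycle, trace_mul_comm, Unitary.coe_star_mul_self, mul_one]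
  simp [trace_diagonal, Finset.sum_neg_distrib]

theorem IsDensity.sum_eigenvalues {ρ : Matrix κ κ ℂ} (hρ : IsDensity ρ) :
    ∑ i, hρ.1.isHermitian.eigenvalues i = 1 := by
  have := hρ.2.symm.trans hρ.1.isHermitian.trace_eq_sum_eigenvalues
  exact Complex.ofReal_injective (by simpa using this.symm)

theorem IsDensity.vonNeumannEntropy_nonneg {ρ : Matrix κ κ ℂ} (hρ : IsDensity ρ) :
    0 ≤ vonNeumannEntropy ρ := by
  have h0 := hρ.1.eigenvalues_nonneg
  rw [vonNeumannEntropy_eq_sum hρ.1.isHermitian]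
  refine Finset.sum_nonneg fun i _ => mul_nonneg (h0 i) (neg_nonneg.2 (Real.log_nonpos (h0 i) ?_))
  rw [← hρ.sum_eigenvalues]
  exact Finset.single_le_sum (fun i _ => h0 i) (Finset.mem_univ i)

/-- Lower bounds for the Shannon entropy in terms of the largest probability. -/
theorem entropy_lower_bounds {q : κ → ℝ} (h0 : ∀ i, 0 ≤ q i) (h1 : ∑ i, q i = 1) {j : κ}
    (hj : ∀ i, q i ≤ q j) :
    -Real.log (q j) ≤ ∑ i, q i * -Real.log (q i) ∧
      (1 - q j) * -Real.log (1 - q j) + q j * (1 - q j) ≤ ∑ i, q i * -Real.log (q i) := by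
  have hpos : 0 < q j := by
    by_contra h
    have : ∑ i, q i ≤ 0 := Finset.sum_nonpos fun i _ => (hj i).trans (not_lt.1 h)
    linarith
  constructor
  · calc -Real.log (q j) = ∑ i, q i * -Real.log (q j) := by rw [← Finset.sum_mul, h1, one_mul]
      _ ≤ _ := Finset.sum_le_sum fun i _ => by
        rcases (h0 i).eq_or_lt with h | h
        · simp [← h]
        · have := Real.log_le_log h (hj i)
          exact mul_le_mul_of_nonneg_left (by linarith) h.le
  -- Every other probability is at most the total 1 - q_j of the others, and the largest one
  -- satisfies -ln q_j ≥ 1 - q_j.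
  · have hsplit : ∑ i ∈ Finset.univ.erase j, q i = 1 - q j := by
      rw [← h1, ← Finset.add_sum_erase _ _ (Finset.mem_univ j)]; ring
    rw [← Finset.add_sum_erase _ _ (Finset.mem_univ j), add_comm]
    refine add_le_add ?_ ?_
    · exact mul_le_mul_of_nonneg_left (by linarith [Real.log_le_sub_one_of_pos hpos]) hpos.le
    · rw [← hsplit, Finset.sum_mul]
      refine Finset.sum_le_sum fun i hi => ?_
      rcases (h0 i).eq_or_lt with h | h
      · simp [← h]
      · have h2 : q i ≤ ∑ i ∈ Finset.univ.erase j, q i :=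
          Finset.single_le_sum (fun i _ => h0 i) hi
        have := Real.log_le_log h h2
        exact mul_le_mul_of_nonneg_left (by linarith) h.le

/-- Put e = 1 - p. For e ≥ 1/4 the first entropy bound gives S ≥ 1/4; for 1/8 ≤ e ≤ 1/4 the second
one does. For e ≤ 1/8 the second bound makes S a large enough multiple of e to dominate (√e + 2e)².
-/
theorem min_covariance_bound_le_sqrt {p S : ℝ} (hp : 0 < p) (hp1 : p ≤ 1)
    (h1 : -Real.log p ≤ S) (h2 : (1 - p) * -Real.log (1 - p) + p * (1 - p) ≤ S) :
    1 ≤ 2 * √S ∨ (1 / 2 ≤ p ∧ 2 * √(p * (1 - p)) + 4 * (p * (1 - p)) ≤ 2 * √S) := by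
  have hquarter : 1 / 4 ≤ S → 1 ≤ 2 * √S := fun h => by
    have : √((1 / 2 : ℝ) ^ 2) ≤ √S := Real.sqrt_le_sqrt (by norm_num; linarith)
    rw [Real.sqrt_sq (by norm_num)] at this
    linarith
  obtain ⟨e, he⟩ : ∃ e, e = 1 - p := ⟨_, rfl⟩
  have hpe : p = 1 - e := by linarith
  rw [← he] at h2 ⊢
  have he0 : 0 ≤ e := by linarith
  have hl2 := Real.log_two_gt_d9
  rcases he0.eq_or_lt with h | hepos
  · right
    rw [← h]
    refine ⟨by linarith, ?_⟩
    simp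
  rcases le_total (1 / 4) e with h | h4
  · left
    exact hquarter (by linarith [Real.log_le_sub_one_of_pos hp])
  rcases le_total (1 / 8) e with h | h8
  · left
    apply hquarter
    have h3 : Real.log e ≤ -(2 * Real.log 2) := by
      have := Real.log_le_log hepos h4
      rwa [show (1 / 4 : ℝ) = (2 ^ 2)⁻¹ by norm_num, Real.log_inv, Real.log_pow,
        Nat.cast_ofNat] at this
    nlinarith
  · right
    refine ⟨by linarith, ?_⟩
    have h3 : Real.log e ≤ -(3 * Real.log 2) := by
      have := Real.log_le_log hepos h8
      rwa [show (1 / 8 : ℝ) = (2 ^ 3)⁻¹ by norm_num, Real.log_inv, Real.log_pow,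
        Nat.cast_ofNat] at this
    -- The constant lies just below 3 ln 2 + 7/8, the value of -ln e + p at e = 1/8.
    have h5 : 2.94 * e ≤ S := by nlinarith
    have h6 : √(p * e) ≤ √e := Real.sqrt_le_sqrt (by nlinarith)
    have h7 : √e + 2 * e ≤ √S := by
      apply Real.le_sqrt_of_sq_le
      have hs := Real.sq_sqrt he0
      have hs0 := Real.sqrt_nonneg e
      -- An upper approximation of √(1/8), tight enough for (1 + 2√e)² ≤ 2.94.
      have hs1 : √e ≤ 0.354 := by
        rw [Real.sqrt_le_left (by norm_num)]; norm_num; linarith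
      have : (√e + 2 * e) ^ 2 = e * (1 + 2 * √e) ^ 2 := by
        nth_rw 2 [← hs]
        nth_rw 3 [← hs]
        ring
      rw [this]
      have : (1 + 2 * √e) ^ 2 ≤ 2.94 := by nlinarith
      nlinarith
    nlinarith

end Entropy

/-! ### Covariance against entropy -/

/-- The covariance of observables of two subsystems is small if the entropy of one is. -/
theorem norm_vecCov_le_entropy {E : Type*} [NormedAddCommGroup E] [InnerProductSpace ℂ E]
    [CompleteSpace E] {κ φ : Type*} [Fintype κ] [DecidableEq κ] [Fintype φ]
    (π : Matrix κ κ ℂ →⋆ₐ[ℂ] (E →L[ℂ] E)) {t : E} (ht : ‖t‖ = 1)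
    {ρ : Matrix κ κ ℂ} (hρ : IsDensity ρ) (hρt : ∀ G, inner ℂ t (π G t) = (ρ * G).trace)
    {A : φ → Matrix κ κ ℂ} {B : φ → E →L[ℂ] E} (hAB : ∀ f G, Commute (π G) (B f))
    {MA MB : ℝ} (hA : VarianceBound (fun f => π (A f)) MA) (hB : VarianceBound B MB) :
    ‖vecCov (fun f => π (A f)) B t‖ ≤ 2 * √(vonNeumannEntropy ρ) * (√MA * √MB) := by
  have hH := hρ.1.isHermitian
  have h0 := hρ.1.eigenvalues_nonneg
  have h1 : ∑ i, hH.eigenvalues i = 1 := hρ.sum_eigenvalues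
  have hne : Nonempty κ := by
    by_contra h
    rw [not_nonempty_iff] at h
    simp at h1
  obtain ⟨j, hj⟩ := Finite.exists_max hH.eigenvalues
  have hpos : 0 < hH.eigenvalues j := by
    by_contra h
    have : ∑ i, hH.eigenvalues i ≤ 0 := Finset.sum_nonpos fun i _ => (hj i).trans (not_lt.1 h)
    linarith
  have hle : hH.eigenvalues j ≤ 1 := by
    rw [← h1]; exact Finset.single_le_sum (fun i _ => h0 i) (Finset.mem_univ j)
  obtain ⟨b1, b2⟩ := entropy_lower_bounds h0 h1 hj
  rw [← vonNeumannEntropy_eq_sum hH] at b1 b2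
  rcases min_covariance_bound_le_sqrt hpos hle b1 b2 with h | ⟨hp2, h⟩
  · exact (norm_vecCov_le hA hB ht).trans (le_mul_of_one_le_left (by positivity) h)
  · set u : κ → ℂ := ⇑(hH.eigenvectorBasis j) with hu
    have huu : star u ⬝ᵥ u = 1 := by
      have := hH.eigenvectorBasis.orthonormal.1 j
      have h2 := inner_self_eq_norm_sq_to_K (𝕜 := ℂ) (hH.eigenvectorBasis j)
      rw [this, EuclideanSpace.inner_eq_star_dotProduct] at h2
      rw [dotProduct_comm]
      simpa using h2
    have hpu : ρ *ᵥ u = ((hH.eigenvalues j : ℝ) : ℂ) • u := by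
      rw [hu, hH.mulVec_eigenvectorBasis j]
      rfl
    obtain ⟨W, hW, hWt, hWA, hn, hPW⟩ := exists_complementary_projection π hρt huu hpos hpu
    refine (norm_vecCov_le_of_dominant hA hB ht (P := π (vecMulVec u (star u))) ⟨?_, ?_⟩ hW rfl hWt
      (fun f => hWA _) (fun f => hAB f _) hPW hn hp2).trans ?_
    · rw [IsIdempotentElem, ← map_mul, ketBra_mul_ketBra, huu, one_smul]
    · rw [IsSelfAdjoint, ← map_star, star_eq_conjTranspose, conjTranspose_vecMulVec, star_star]
    · exact mul_le_mul_of_nonneg_right h (by positivity)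

/-! ### Density matrices as mixtures of vectors -/

section States

theorem norm_sq_eq_one_iff {κ : Type*} [Fintype κ] (x : EuclideanSpace ℂ κ) :
    ‖x‖ ^ 2 = 1 ↔ star x.ofLp ⬝ᵥ x.ofLp = 1 := by
  have h := inner_self_eq_norm_sq_to_K (𝕜 := ℂ) x
  rw [EuclideanSpace.inner_eq_star_dotProduct, dotProduct_comm] at h
  rw [h]
  constructor
  · intro h1
    have : ((‖x‖ ^ 2 : ℝ) : ℂ) = 1 := by rw [h1]; simp
    simpa using this
  · intro h1
    exact Complex.ofReal_injective (by simpa using h1)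

theorem isDensity_pureState {κ : Type*} [Fintype κ] {t : κ → ℂ} (ht : star t ⬝ᵥ t = 1) : IsDensity (pureState t) :=
  ⟨posSemidef_vecMulVec_self_star t, by rw [pureState, trace_vecMulVec, dotProduct_comm, ht]⟩

variable {κ : Type*} [Fintype κ] [DecidableEq κ]

/-- Matrices acting on Euclidean space. -/
def euclideanOp : Matrix κ κ ℂ →⋆ₐ[ℂ] (EuclideanSpace ℂ κ →L[ℂ] EuclideanSpace ℂ κ) :=
  (toEuclideanCLM (n := κ) (𝕜 := ℂ) : Matrix κ κ ℂ →⋆ₐ[ℂ] _)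

theorem ofLp_euclideanOp (G : Matrix κ κ ℂ) (x : EuclideanSpace ℂ κ) :
    (euclideanOp G x).ofLp = G *ᵥ x.ofLp := rfl

theorem inner_euclideanOp (G : Matrix κ κ ℂ) (x : EuclideanSpace ℂ κ) :
    inner ℂ x (euclideanOp G x) = star x.ofLp ⬝ᵥ (G *ᵥ x.ofLp) := by
  rw [EuclideanSpace.inner_eq_star_dotProduct, ofLp_euclideanOp, dotProduct_comm]

theorem trace_pureState_mul (x : EuclideanSpace ℂ κ) (G : Matrix κ κ ℂ) :
    (pureState x.ofLp * G).trace = inner ℂ x (euclideanOp G x) := by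
  rw [inner_euclideanOp, pureState, vecMulVec_mul, trace_vecMulVec, dotProduct_comm,
    dotProduct_mulVec]

theorem inner_euclideanOp_conjTranspose_mul (G : Matrix κ κ ℂ) (x : EuclideanSpace ℂ κ) :
    inner ℂ x (euclideanOp (Gᴴ * G) x) = ((‖euclideanOp G x‖ ^ 2 : ℝ) : ℂ) := by
  rw [← starAlgHom_mul_apply, inner_starAlgHom_apply, conjTranspose_conjTranspose,
    inner_self_eq_norm_sq_to_K]
  simp

/-- Every state is an orthogonal mixture of pure states. -/
theorem IsDensity.exists_decomposition {ρ : Matrix κ κ ℂ} (hρ : IsDensity ρ) :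
    ∃ v : κ → EuclideanSpace ℂ κ, Pairwise (fun a b => inner ℂ (v a) (v b) = (0 : ℂ)) ∧
      ∑ a, ‖v a‖ ^ 2 = 1 ∧
      ∀ G, (ρ * G).trace = ∑ a, inner ℂ (v a) (euclideanOp G (v a)) := by
  have hH := hρ.1.isHermitian
  set u := hH.eigenvectorBasis with hu
  set q := hH.eigenvalues with hq
  have hq0 : ∀ j, 0 ≤ q j := hρ.1.eigenvalues_nonneg
  have hsq : ∀ j, (√(q j) : ℂ) * (√(q j) : ℂ) = (q j : ℂ) := fun j => by
    rw [← Complex.ofReal_mul, Real.mul_self_sqrt (hq0 j)]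
  have hdec : ρ = ∑ j, (q j : ℂ) • pureState (u j).ofLp := by
    conv_lhs => rw [hH.spectral_theorem, Unitary.conjStarAlgAut_apply]
    ext a b
    rw [Matrix.sum_apply, mul_apply]
    refine Finset.sum_congr rfl fun j _ => ?_
    rw [mul_diagonal, star_eq_conjTranspose, conjTranspose_apply, IsHermitian.eigenvectorUnitary_apply,
      IsHermitian.eigenvectorUnitary_apply, Matrix.smul_apply, pureState, vecMulVec_apply, smul_eq_mul]
    simp only [Function.comp_apply, Pi.star_apply]
    simp only [← hu, ← hq, Complex.coe_algebraMap]
    ring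
  have htr : ∀ G, (ρ * G).trace = ∑ j, (q j : ℂ) * inner ℂ (u j) (euclideanOp G (u j)) := by
    intro G
    rw [hdec, Finset.sum_mul, trace_sum]
    refine Finset.sum_congr rfl fun j _ => ?_
    rw [smul_mul, trace_smul, trace_pureState_mul, smul_eq_mul]
  refine ⟨fun j => (√(q j) : ℂ) • u j, ?_, ?_, ?_⟩
  · intro a b hab
    change inner ℂ ((√(q a) : ℂ) • u a) ((√(q b) : ℂ) • u b) = 0
    rw [inner_smul_left, inner_smul_right, u.orthonormal.2 hab]
    simp
  · have h1 := htr 1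
    rw [mul_one, hρ.2] at h1
    simp only [map_one, one_apply_eq_self, inner_self_eq_norm_sq_to_K,
      u.orthonormal.1] at h1
    have h2 : ∑ j, q j = 1 := Complex.ofReal_injective (by simpa using h1.symm)
    rw [← h2]
    refine Finset.sum_congr rfl fun j _ => ?_
    rw [norm_smul, u.orthonormal.1, mul_one, Complex.norm_real, Real.norm_eq_abs, sq_abs,
      Real.sq_sqrt (hq0 j)]
  · intro G
    rw [htr]
    refine Finset.sum_congr rfl fun j _ => ?_
    rw [map_smul, inner_smul_left, inner_smul_right, Complex.conj_ofReal, ← mul_assoc, hsq]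

theorem opVariance_pureState (x : EuclideanSpace ℂ κ) (G : Matrix κ κ ℂ) :
    opVariance (pureState x.ofLp) G
      = ‖euclideanOp G x‖ ^ 2 - ‖inner ℂ x (euclideanOp G x)‖ ^ 2 := by
  rw [opVariance, trace_pureState_mul, trace_pureState_mul, inner_euclideanOp_conjTranspose_mul,
    Complex.ofReal_re]

end States

/-! ### Variances are maximized by pure states -/

section PureMaximum

/-- A positive semidefinite Hermitian 2×2 matrix of determinant zero has rank at most one. -/
theorem exists_amplitudes {a d : ℝ} {z : ℂ} (ha : 0 ≤ a) (hd : 0 ≤ d) (h : a * d = ‖z‖ ^ 2) :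
    ∃ x y : ℂ, ‖x‖ ^ 2 = a ∧ ‖y‖ ^ 2 = d ∧ starRingEnd ℂ x * y = z := by
  rcases ha.eq_or_lt with h0 | h0
  · have hz : z = 0 := by
      rw [← h0, zero_mul] at h
      exact norm_eq_zero.1 (pow_eq_zero_iff two_ne_zero |>.1 h.symm)
    exact ⟨0, (√d : ℂ), by simp [← h0], by simp [Real.sq_sqrt hd], by simp [hz]⟩
  · have hs : (√a : ℂ) ≠ 0 := by exact_mod_cast (Real.sqrt_pos.2 h0).ne'
    refine ⟨(√a : ℂ), z / (√a : ℂ), by simp [Real.sq_sqrt ha], ?_, ?_⟩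
    · rw [norm_div, div_pow, ← h, Complex.norm_real, Real.norm_eq_abs, sq_abs, Real.sq_sqrt ha]
      field_simp
    · rw [Complex.conj_ofReal]; field_simp

/-- A quadratic with constant term one and negative leading coefficient has roots of both signs. -/
theorem exists_root_of_sign {δ b q : ℝ} (hδ : δ < 0) :
    ∃ t : ℝ, δ * (t * t) + b * t + 1 = 0 ∧ 0 ≤ t * q := by
  obtain ⟨t, ht⟩ := exists_quadratic_eq_zero (a := δ) (b := b) (c := 1) hδ.ne
    ⟨√(discrim δ b 1), by rw [Real.mul_self_sqrt]; rw [discrim]; nlinarith [sq_nonneg b]⟩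
  have ht0 : t ≠ 0 := by rintro rfl; norm_num at ht
  rcases le_total 0 (t * q) with h | h
  · exact ⟨t, ht, h⟩
  -- The other root: the product of the roots is 1/δ < 0, so it has the opposite sign.
  · refine ⟨1 / (δ * t), ?_, ?_⟩
    · have := hδ.ne
      field_simp
      linarith
    · have : 1 / (δ * t) * q = (-(t * q)) * (1 / (-δ * (t * t))) := by
        have := hδ.ne
        field_simp
      rw [this]
      have : 0 < t * t := mul_self_pos.2 ht0
      have : 0 < -δ * (t * t) := mul_pos (by linarith) this
      exact mul_nonneg (by linarith) (by positivity)

variable {E : Type*} [NormedAddCommGroup E] [InnerProductSpace ℂ E]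

/-- The mixture has coefficient matrix 1 on v₁, v₂; deform it to 1 + tH until it has rank one. Take
H Hermitian with diagonal (s n₂, -s n₁) and off-diagonal entry z, which preserves the total norm.
Preserving the expectation of `G` imposes two real linear conditions on the three real parameters
(s, z), so some H ≠ 0 remains. Since det H < 0, det(1 + tH) vanishes for t of either sign. The
second moment of `G` is affine in t, so one sign does not decrease it. -/
theorem exists_superposition (G : E →L[ℂ] E) {v₁ v₂ : E} (h : inner ℂ v₁ v₂ = (0 : ℂ)) :
    ∃ x y : ℂ, ‖x • v₁ + y • v₂‖ ^ 2 = ‖v₁‖ ^ 2 + ‖v₂‖ ^ 2 ∧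
      inner ℂ (x • v₁ + y • v₂) (G (x • v₁ + y • v₂))
        = inner ℂ v₁ (G v₁) + inner ℂ v₂ (G v₂) ∧
      ‖G v₁‖ ^ 2 + ‖G v₂‖ ^ 2 ≤ ‖G (x • v₁ + y • v₂)‖ ^ 2 := by
  by_cases h1 : v₁ = 0
  · exact ⟨0, 1, by simp [h1], by simp [h1], by simp [h1]⟩
  by_cases h2 : v₂ = 0
  · exact ⟨1, 0, by simp [h2], by simp [h2], by simp [h2]⟩
  have hn1 : 0 < ‖v₁‖ ^ 2 := by positivity
  have hn2 : 0 < ‖v₂‖ ^ 2 := by positivity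
  set n₁ := ‖v₁‖ ^ 2
  set n₂ := ‖v₂‖ ^ 2
  set g₁₁ : ℂ := inner ℂ v₁ (G v₁)
  set g₂₂ : ℂ := inner ℂ v₂ (G v₂)
  set g₁₂ : ℂ := inner ℂ v₁ (G v₂)
  set g₂₁ : ℂ := inner ℂ v₂ (G v₁)
  let L : ℝ × ℂ →ₗ[ℝ] ℂ :=
    { toFun := fun p => (p.1 : ℂ) * (n₂ * g₁₁ - n₁ * g₂₂) + p.2 * g₁₂ + starRingEnd ℂ p.2 * g₂₁
      map_add' := fun p q => by simp; ring
      map_smul' := fun c p => by simp; ring }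
  have hker : LinearMap.ker L ≠ ⊥ := by
    apply LinearMap.ker_ne_bot_of_finrank_lt
    rw [Module.finrank_prod, Complex.finrank_real_complex, Module.finrank_self]
    norm_num
  obtain ⟨⟨s, z⟩, hsz, hne⟩ := (Submodule.ne_bot_iff _).1 hker
  have hL : (s : ℂ) * (n₂ * g₁₁ - n₁ * g₂₂) + z * g₁₂ + starRingEnd ℂ z * g₂₁ = 0 := hsz
  have hδ : (s * n₂) * (-(s * n₁)) - ‖z‖ ^ 2 < 0 := by
    by_cases hs : s = 0
    · have hz : z ≠ 0 := fun hz => hne (by rw [hs, hz]; rfl)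
      have : 0 < ‖z‖ ^ 2 := by positivity
      rw [hs]; linarith
    · have : 0 < s ^ 2 * (n₁ * n₂) := by positivity
      nlinarith [sq_nonneg ‖z‖]
  set q := (s * n₂) * ‖G v₁‖ ^ 2 + (-(s * n₁)) * ‖G v₂‖ ^ 2
    + 2 * (z * inner ℂ (G v₁) (G v₂)).re with hq
  obtain ⟨t, ht, htq⟩ := exists_root_of_sign (b := s * n₂ + -(s * n₁)) (q := q) hδ
  set a := 1 + t * (s * n₂) with ha
  set d := 1 + t * (-(s * n₁)) with hd
  have had : a * d = ‖(t : ℂ) * z‖ ^ 2 := by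
    rw [norm_mul, Complex.norm_real, mul_pow, Real.norm_eq_abs, sq_abs, ha, hd]
    linear_combination ht
  -- At the root the trace is 1 - t² det H, which is positive; with zero-determinant data this makes
  -- both diagonal entries nonnegative.
  have hsum : 0 ≤ a + d := by
    have : a + d = 1 + -(s * n₂ * -(s * n₁) - ‖z‖ ^ 2) * (t * t) := by
      rw [ha, hd]; linear_combination ht
    rw [this]
    have := mul_nonneg (neg_nonneg.2 hδ.le) (mul_self_nonneg t)
    linarith
  have had0 : 0 ≤ a * d := by rw [had]; positivity
  have ha0 : 0 ≤ a := by
    by_contra hc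
    push Not at hc
    nlinarith
  have hd0 : 0 ≤ d := by
    by_contra hc
    push Not at hc
    nlinarith
  obtain ⟨x, y, hx, hy, hxy⟩ := exists_amplitudes ha0 hd0 had
  have hyx : starRingEnd ℂ y * x = starRingEnd ℂ ((t : ℂ) * z) := by
    rw [← hxy]; simp [mul_comm]
  have hx' : starRingEnd ℂ x * x = (a : ℂ) := by
    rw [Complex.conj_mul', ← hx]; push_cast; rfl
  have hy' : starRingEnd ℂ y * y = (d : ℂ) := by
    rw [Complex.conj_mul', ← hy]; push_cast; rfl
  have expand : ∀ F : E →L[ℂ] E, ∀ w₁ w₂ : E, inner ℂ (x • w₁ + y • w₂) (x • F v₁ + y • F v₂)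
      = a * inner ℂ w₁ (F v₁) + d * inner ℂ w₂ (F v₂) + (t * z) * inner ℂ w₁ (F v₂)
        + starRingEnd ℂ (t * z) * inner ℂ w₂ (F v₁) := by
    intro F w₁ w₂
    rw [← hx', ← hy', ← hxy]
    simp only [inner_add_left, inner_add_right, inner_smul_left, inner_smul_right, map_mul,
      Complex.conj_conj]
    ring
  refine ⟨x, y, ?_, ?_, ?_⟩
  · have h21 : inner ℂ v₂ v₁ = (0 : ℂ) := by rw [← inner_conj_symm, h, map_zero]
    have e := expand (ContinuousLinearMap.id ℂ E) v₁ v₂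
    simp only [ContinuousLinearMap.id_apply, h, h21, mul_zero, add_zero,
      inner_self_eq_norm_sq_to_K] at e
    have e' : ‖x • v₁ + y • v₂‖ ^ 2 = a * n₁ + d * n₂ :=
      Complex.ofReal_injective (by simpa [n₁, n₂] using e)
    rw [e', ha, hd]; ring
  · rw [map_add, map_smul, map_smul, expand G v₁ v₂, ha, hd]
    push_cast
    simp only [map_mul, Complex.conj_ofReal]
    linear_combination (t : ℂ) * hL
  · have e := expand G (G v₁) (G v₂)
    have e' := congrArg Complex.re e
    rw [map_add, map_smul, map_smul]
    have r : ∀ w : E, (inner ℂ w w).re = ‖w‖ ^ 2 := fun w => by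
      rw [inner_self_eq_norm_sq_to_K]; norm_cast
    have c : (starRingEnd ℂ ((t : ℂ) * z) * inner ℂ (G v₂) (G v₁)).re
        = t * (z * inner ℂ (G v₁) (G v₂)).re := by
      rw [← inner_conj_symm (G v₂) (G v₁), ← map_mul, Complex.conj_re, mul_assoc,
        Complex.re_ofReal_mul]
    rw [Complex.add_re, Complex.add_re, Complex.add_re, c, mul_assoc, Complex.re_ofReal_mul,
      Complex.re_ofReal_mul, Complex.re_ofReal_mul, r, r, r] at e'
    rw [e', ha, hd]
    have : t * q = t * ((s * n₂) * ‖G v₁‖ ^ 2 + (-(s * n₁)) * ‖G v₂‖ ^ 2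
      + 2 * (z * inner ℂ (G v₁) (G v₂)).re) := by rw [hq]
    linarith

/-- Merge the vectors one at a time. Keeping `w` in the span of those already used preserves its
orthogonality to the next one. -/
theorem exists_superposition_finset (G : E →L[ℂ] E) {J : Type*} [DecidableEq J] (v : J → E)
    (hv : Pairwise fun a b => inner ℂ (v a) (v b) = (0 : ℂ)) (s : Finset J) :
    ∃ w ∈ Submodule.span ℂ (v '' s), ‖w‖ ^ 2 = ∑ a ∈ s, ‖v a‖ ^ 2 ∧
      inner ℂ w (G w) = ∑ a ∈ s, inner ℂ (v a) (G (v a)) ∧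
      ∑ a ∈ s, ‖G (v a)‖ ^ 2 ≤ ‖G w‖ ^ 2 := by
  induction s using Finset.induction_on with
  | empty => exact ⟨0, by simp, by simp, by simp, by simp⟩
  | insert b s hb ih =>
    obtain ⟨w, hw, h1, h2, h3⟩ := ih
    have horth : inner ℂ (v b) w = (0 : ℂ) := by
      have hle : Submodule.span ℂ (v '' s) ≤ LinearMap.ker (innerSL ℂ (v b)).toLinearMap := by
        rw [Submodule.span_le]
        rintro _ ⟨a, ha, rfl⟩
        exact hv fun h => hb (by rw [h]; exact ha)
      exact hle hw
    obtain ⟨x, y, k1, k2, k3⟩ := exists_superposition G horth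
    refine ⟨x • v b + y • w, ?_, ?_, ?_, ?_⟩
    · refine add_mem (Submodule.smul_mem _ _ (Submodule.subset_span ⟨b, by simp, rfl⟩))
        (Submodule.smul_mem _ _ (Submodule.span_mono ?_ hw))
      gcongr
      simp
    · rw [k1, h1, Finset.sum_insert hb]
    · rw [k2, h2, Finset.sum_insert hb]
    · rw [Finset.sum_insert hb]
      linarith

/-- The variance in a mixed state is at most the variance in some pure state. -/
theorem IsDensity.exists_pure_opVariance_ge {κ : Type*} [Fintype κ] [DecidableEq κ]
    {ρ : Matrix κ κ ℂ} (hρ : IsDensity ρ) (G : Matrix κ κ ℂ) :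
    ∃ t : κ → ℂ, star t ⬝ᵥ t = 1 ∧ opVariance ρ G ≤ opVariance (pureState t) G := by
  obtain ⟨v, hv, h1, htr⟩ := hρ.exists_decomposition
  obtain ⟨w, -, k1, k2, k3⟩ := exists_superposition_finset (euclideanOp G) v hv Finset.univ
  refine ⟨w.ofLp, (norm_sq_eq_one_iff w).1 (k1.trans h1), ?_⟩
  rw [opVariance_pureState, opVariance, htr, htr, k2, Complex.re_sum]
  simp only [inner_euclideanOp_conjTranspose_mul, Complex.ofReal_re]
  linarith

end PureMaximum

/-! ### Second-order expansion, uniform in the state -/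

section Asymptotics

open scoped Matrix.Norms.L2Operator

theorem opVariance_smul {κ : Type*} [Fintype κ] (ρ : Matrix κ κ ℂ) (z : ℂ) (G : Matrix κ κ ℂ) :
    opVariance ρ (z • G) = ‖z‖ ^ 2 * opVariance ρ G := by
  rw [opVariance, opVariance, conjTranspose_smul]
  simp only [smul_mul, Matrix.mul_smul, smul_smul, trace_smul, smul_eq_mul, norm_mul, mul_pow]
  rw [show z * star z = ((‖z‖ ^ 2 : ℝ) : ℂ) by
    rw [← starRingEnd_apply, Complex.mul_conj']; push_cast; rfl, Complex.re_ofReal_mul]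
  ring

variable {κ : Type*} [Fintype κ] [DecidableEq κ]

theorem IsDensity.norm_trace_mul_le {ρ : Matrix κ κ ℂ} (hρ : IsDensity ρ) (G : Matrix κ κ ℂ) :
    ‖(ρ * G).trace‖ ≤ ‖G‖ := by
  obtain ⟨v, -, h1, htr⟩ := hρ.exists_decomposition
  rw [htr]
  calc ‖∑ a, inner ℂ (v a) (euclideanOp G (v a))‖
      ≤ ∑ a, ‖G‖ * ‖v a‖ ^ 2 := (norm_sum_le _ _).trans <| Finset.sum_le_sum fun a _ => by
        refine (norm_inner_le_norm _ _).trans ?_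
        have : ‖euclideanOp G (v a)‖ ≤ ‖G‖ * ‖v a‖ := (euclideanOp G).le_opNorm (v a)
        calc ‖v a‖ * ‖euclideanOp G (v a)‖ ≤ ‖v a‖ * (‖G‖ * ‖v a‖) := by gcongr
          _ = ‖G‖ * ‖v a‖ ^ 2 := by ring
    _ = ‖G‖ := by rw [← Finset.mul_sum, h1, mul_one]

theorem norm_conjTranspose_mul_le (X Y : Matrix κ κ ℂ) : ‖Xᴴ * Y‖ ≤ ‖X‖ * ‖Y‖ := by
  refine (l2_opNorm_mul _ _).trans ?_
  rw [l2_opNorm_conjTranspose]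

theorem IsDensity.opVariance_le {ρ : Matrix κ κ ℂ} (hρ : IsDensity ρ) (G : Matrix κ κ ℂ) :
    opVariance ρ G ≤ ‖G‖ ^ 2 := by
  have h1 := (Complex.re_le_norm _).trans (hρ.norm_trace_mul_le (Gᴴ * G))
  have h2 := norm_conjTranspose_mul_le G G
  have h3 : 0 ≤ ‖(ρ * G).trace‖ ^ 2 := by positivity
  rw [opVariance]
  nlinarith

theorem opVariance_smul_one_add {ρ : Matrix κ κ ℂ} (hρ : IsDensity ρ) (z : ℂ) (G : Matrix κ κ ℂ) :
    opVariance ρ (z • 1 + G) = opVariance ρ G := by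
  have hc : (ρ * Gᴴ).trace = starRingEnd ℂ (ρ * G).trace := by
    rw [starRingEnd_apply, ← trace_conjTranspose, conjTranspose_mul, hρ.1.isHermitian.eq,
      trace_mul_comm]
  have e1 : (ρ * ((z • 1 + G)ᴴ * (z • 1 + G))).trace
      = starRingEnd ℂ z * z + starRingEnd ℂ z * (ρ * G).trace
        + z * starRingEnd ℂ (ρ * G).trace + (ρ * (Gᴴ * G)).trace := by
    rw [← hc, conjTranspose_add, conjTranspose_smul, conjTranspose_one]
    simp only [add_mul, mul_add, smul_mul, Matrix.mul_smul, one_mul, mul_one, trace_add, trace_smul,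
      hρ.2, smul_eq_mul, starRingEnd_apply]
    ring
  have e2 : (ρ * (z • 1 + G)).trace = z + (ρ * G).trace := by
    simp only [mul_add, Matrix.mul_smul, mul_one, trace_add, trace_smul, hρ.2, smul_eq_mul]
  rw [opVariance, opVariance, e1, e2, ← Complex.normSq_eq_norm_sq, ← Complex.normSq_eq_norm_sq]
  simp only [Complex.normSq_apply, Complex.add_re, Complex.add_im, Complex.mul_re, Complex.conj_re,
    Complex.conj_im]
  ring

/-- The error involves only operator norms and not `ρ`, which is what allows suprema over states to
be expanded. -/
theorem IsDensity.abs_opVariance_add_sub_le {ρ : Matrix κ κ ℂ} (hρ : IsDensity ρ)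
    (X R : Matrix κ κ ℂ) :
    |opVariance ρ (X + R) - opVariance ρ X| ≤ 4 * (‖X‖ * ‖R‖) + 2 * ‖R‖ ^ 2 := by
  have e1 : (ρ * ((X + R)ᴴ * (X + R))).trace = (ρ * (Xᴴ * X)).trace + (ρ * (Xᴴ * R)).trace
      + (ρ * (Rᴴ * X)).trace + (ρ * (Rᴴ * R)).trace := by
    rw [conjTranspose_add]
    simp only [add_mul, mul_add, trace_add]
    ring
  have h1 := (Complex.abs_re_le_norm _).trans
    ((hρ.norm_trace_mul_le (Xᴴ * R)).trans (norm_conjTranspose_mul_le X R))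
  have h2 := (Complex.abs_re_le_norm _).trans
    ((hρ.norm_trace_mul_le (Rᴴ * X)).trans (norm_conjTranspose_mul_le R X))
  have h3 := (Complex.abs_re_le_norm _).trans
    ((hρ.norm_trace_mul_le (Rᴴ * R)).trans (norm_conjTranspose_mul_le R R))
  have h4 := hρ.norm_trace_mul_le X
  have h5 := hρ.norm_trace_mul_le R
  have h6 : |‖(ρ * (X + R)).trace‖ ^ 2 - ‖(ρ * X).trace‖ ^ 2| ≤ 2 * (‖X‖ * ‖R‖) + ‖R‖ ^ 2 := by
    rw [mul_add, trace_add]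
    set x := (ρ * X).trace
    set r := (ρ * R).trace
    have k1 : |‖x + r‖ - ‖x‖| ≤ ‖r‖ := by
      simpa using abs_norm_sub_norm_le (x + r) x
    have k2 : ‖x + r‖ + ‖x‖ ≤ 2 * ‖x‖ + ‖r‖ := by linarith [norm_add_le x r]
    calc |‖x + r‖ ^ 2 - ‖x‖ ^ 2| = |‖x + r‖ - ‖x‖| * (‖x + r‖ + ‖x‖) := by
          rw [sq_sub_sq, abs_mul, abs_of_nonneg (by positivity : 0 ≤ ‖x + r‖ + ‖x‖), mul_comm]
      _ ≤ ‖r‖ * (2 * ‖x‖ + ‖r‖) := by gcongr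
      _ ≤ ‖R‖ * (2 * ‖X‖ + ‖R‖) := by gcongr
      _ = _ := by ring
  rw [opVariance, opVariance, e1, Complex.add_re, Complex.add_re, Complex.add_re]
  rw [abs_le] at *
  constructor <;> nlinarith

variable {φ : Type*} [Fintype φ]

/-- The zeroth order acts on the target as a scalar, so it drops out of the variance and the
probabilities start at α². -/
theorem restrictOp_firstOrder {κ : Type*} [DecidableEq κ] [DecidableEq φ] (T : Matrix (φ × κ) (φ × κ) ℂ) (i : φ → ℂ) (f : φ)
    (z : ℂ) : restrictOp (1 + z • T) i f = i f • 1 + z • restrictOp T i f := by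
  ext x y
  simp only [restrictOp, Matrix.add_apply, Matrix.smul_apply, add_mul, Finset.sum_add_distrib,
    smul_eq_mul, Finset.mul_sum, mul_assoc]
  congr 1
  simp only [one_apply, Prod.mk.injEq]
  by_cases h : x = y <;> simp [h]

/-- To second order, the orthogonal scattering probabilities are variances, uniformly in the
target state. -/
theorem exists_orthProbToMixed_expansion [DecidableEq φ] {S : ℝ → Matrix (φ × κ) (φ × κ) ℂ}
    {T : Matrix (φ × κ) (φ × κ) ℂ} (hS : HasFirstOrderTerm S T) (i : φ → ℂ) (f : φ) :
    ∃ e : ℝ → ℝ, e =O[𝓝 0] (fun α : ℝ => α ^ 3) ∧ ∀ α (ρ : Matrix κ κ ℂ), IsDensity ρ →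
      |orthProbToMixed (S α) i f ρ - α ^ 2 * opVariance ρ (restrictOp T i f)| ≤ e α := by
  set G := restrictOp T i f with hG
  let R : ℝ → Matrix κ κ ℂ := fun α =>
    restrictOp (S α) i f - restrictOp (1 + (Complex.I * (α : ℂ)) • T) i f
  have hR : R =O[𝓝 0] (fun α : ℝ => α ^ 2) := by
    have hentry : ∀ x y, (fun α => R α x y) =O[𝓝 0] (fun α : ℝ => α ^ 2) := by
      intro x y
      have : (fun α => R α x y) = fun α => ∑ g, i g * (S α (f, x) (g, y)
          - (1 + (Complex.I * (α : ℂ)) • T) (f, x) (g, y)) := by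
        funext α
        simp only [R, Matrix.sub_apply, restrictOp, ← Finset.sum_sub_distrib]
        exact Finset.sum_congr rfl fun g _ => by ring
      rw [this]
      exact IsBigO.fun_sum fun g _ => (hS (f, x) (g, y)).const_mul_left (i g)
    -- Expansion in matrix units turns the entrywise estimate into one for the operator norm.
    have : R = fun α => ∑ x, ∑ y, R α x y • Matrix.single x y (1 : ℂ) := by
      funext α
      conv_lhs => rw [matrix_eq_sum_single (R α)]
      simp
    rw [this]
    refine IsBigO.fun_sum fun x _ => IsBigO.fun_sum fun y _ => ?_
    have := (hentry x y).smul (isBigO_refl (fun _ : ℝ => Matrix.single x y (1 : ℂ)) (𝓝 0))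
    refine this.trans (IsBigO.of_bound ‖Matrix.single x y (1 : ℂ)‖ (Filter.Eventually.of_forall
      fun α => ?_))
    rw [norm_smul, mul_comm]
  refine ⟨fun α => 4 * (|α| * ‖G‖ * ‖R α‖) + 2 * ‖R α‖ ^ 2, ?_, ?_⟩
  · have hα : (fun α : ℝ => |α|) =O[𝓝 0] (fun α : ℝ => α) := (isBigO_refl _ _).abs_left
    have h1 : (fun α : ℝ => 4 * (|α| * ‖G‖ * ‖R α‖)) =O[𝓝 0] (fun α : ℝ => α ^ 3) := by
      refine IsBigO.const_mul_left ?_ 4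
      have := ((hα.mul (isBigO_refl (fun _ : ℝ => ‖G‖) (𝓝 0))).mul hR.norm_left)
      refine this.trans (IsBigO.of_bound ‖G‖ (Filter.Eventually.of_forall fun α => ?_))
      simp only [norm_mul, norm_pow, norm_norm]
      apply le_of_eq
      ring
    have h2 : (fun α : ℝ => 2 * ‖R α‖ ^ 2) =O[𝓝 0] (fun α : ℝ => α ^ 3) := by
      refine IsBigO.const_mul_left ?_ 2
      refine (hR.norm_left.pow 2).trans ?_
      simp only [← pow_mul]
      exact (isLittleO_pow_pow (𝕜 := ℝ) (by norm_num : 3 < 2 * 2)).isBigO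
    exact h1.add h2
  · intro α ρ hρ
    have hdec : restrictOp (S α) i f = i f • 1 + ((Complex.I * (α : ℂ)) • G + R α) := by
      rw [← add_assoc, hG, ← restrictOp_firstOrder]
      simp only [R]
      abel
    have hn : ‖Complex.I * (α : ℂ)‖ = |α| := by simp
    have h1 : α ^ 2 * opVariance ρ G = opVariance ρ ((Complex.I * (α : ℂ)) • G) := by
      rw [opVariance_smul, hn, sq_abs]
    rw [orthProbToMixed, hdec, opVariance_smul_one_add hρ, h1]
    refine (hρ.abs_opVariance_add_sub_le _ _).trans (le_of_eq ?_)
    rw [norm_smul, hn]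

/-- A uniform approximation passes to suprema. Nonemptiness and the bound `M` ensure that both
`sSup` are genuine least upper bounds and not default values. -/
theorem abs_sSup_sub_le {Ω : Type*} {P : Ω → Prop} {F G : Ω → ℝ} {a e M : ℝ} (ha : 0 ≤ a)
    (hne : ∃ ω, P ω) (hM : ∀ ω, P ω → G ω ≤ M) (h : ∀ ω, P ω → |F ω - a * G ω| ≤ e) :
    |sSup {p | ∃ ω, P ω ∧ p = F ω} - a * sSup {p | ∃ ω, P ω ∧ p = G ω}| ≤ e := by
  obtain ⟨ω₀, hω₀⟩ := hne
  have bG : BddAbove {p | ∃ ω, P ω ∧ p = G ω} := ⟨M, by rintro _ ⟨ω, hω, rfl⟩; exact hM ω hω⟩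
  have bF : BddAbove {p | ∃ ω, P ω ∧ p = F ω} := ⟨a * M + e, by
    rintro _ ⟨ω, hω, rfl⟩
    have := mul_le_mul_of_nonneg_left (hM ω hω) ha
    linarith [(abs_le.1 (h ω hω)).2]⟩
  rw [abs_le]
  constructor
  · have : a * sSup {p | ∃ ω, P ω ∧ p = G ω} ≤ sSup {p | ∃ ω, P ω ∧ p = F ω} + e := by
      rw [← smul_eq_mul, ← Real.sSup_smul_of_nonneg ha]
      refine csSup_le ⟨_, Set.smul_mem_smul_set ⟨ω₀, hω₀, rfl⟩⟩ ?_
      rintro _ ⟨_, ⟨ω, hω, rfl⟩, rfl⟩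
      have := le_csSup bF ⟨ω, hω, rfl⟩
      simp only [smul_eq_mul]
      linarith [(abs_le.1 (h ω hω)).1]
    linarith
  · have : sSup {p | ∃ ω, P ω ∧ p = F ω} ≤ a * sSup {p | ∃ ω, P ω ∧ p = G ω} + e := by
      refine csSup_le ⟨_, ω₀, hω₀, rfl⟩ ?_
      rintro _ ⟨ω, hω, rfl⟩
      have := mul_le_mul_of_nonneg_left (le_csSup bG ⟨ω, hω, rfl⟩) ha
      linarith [(abs_le.1 (h ω hω)).2]
    linarith

/-- The leading coefficient of `maxOrthProb`. -/
def maxVariance (T : Matrix (φ × κ) (φ × κ) ℂ) (i : φ → ℂ) : ℝ :=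
  sSup {p : ℝ | ∃ ρ : Matrix κ κ ℂ, IsDensity ρ ∧ p = ∑ f, opVariance ρ (restrictOp T i f)}

/-- The leading coefficient of `maxOrthProbTo`. -/
def maxVarianceTo (T : Matrix (φ × κ) (φ × κ) ℂ) (i : φ → ℂ) (f : φ) : ℝ :=
  sSup {p : ℝ | ∃ t : κ → ℂ, star t ⬝ᵥ t = 1 ∧ p = opVariance (pureState t) (restrictOp T i f)}

theorem IsDensity.sum_opVariance_le_maxVariance (T : Matrix (φ × κ) (φ × κ) ℂ) (i : φ → ℂ)
    {ρ : Matrix κ κ ℂ} (hρ : IsDensity ρ) :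
    ∑ f, opVariance ρ (restrictOp T i f) ≤ maxVariance T i := by
  refine le_csSup ⟨∑ f, ‖restrictOp T i f‖ ^ 2, ?_⟩ ⟨ρ, hρ, rfl⟩
  rintro _ ⟨σ, hσ, rfl⟩
  exact Finset.sum_le_sum fun f _ => hσ.opVariance_le _

theorem exists_unit_vector [Nonempty κ] : ∃ t : κ → ℂ, star t ⬝ᵥ t = 1 := by
  obtain ⟨a⟩ := ‹Nonempty κ›
  exact ⟨Pi.single a 1, by simp⟩

/-- Reduces (b) to (a): bound each variance separately, choosing for each `f` its own dominating
pure state. -/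
theorem maxVariance_le_sum_maxVarianceTo [Nonempty κ] (T : Matrix (φ × κ) (φ × κ) ℂ) (i : φ → ℂ) :
    maxVariance T i ≤ ∑ f, maxVarianceTo T i f := by
  obtain ⟨t, ht⟩ := exists_unit_vector (κ := κ)
  refine csSup_le ⟨_, pureState t, isDensity_pureState ht, rfl⟩ ?_
  rintro _ ⟨ρ, hρ, rfl⟩
  refine Finset.sum_le_sum fun f _ => ?_
  obtain ⟨w, hw, h⟩ := hρ.exists_pure_opVariance_ge (restrictOp T i f)
  refine h.trans (le_csSup ⟨‖restrictOp T i f‖ ^ 2, ?_⟩ ⟨w, hw, rfl⟩)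
  rintro _ ⟨v, hv, rfl⟩
  exact (isDensity_pureState hv).opVariance_le _

theorem orthProb_isBigO [DecidableEq φ] {S : ℝ → Matrix (φ × κ) (φ × κ) ℂ} {T : Matrix (φ × κ) (φ × κ) ℂ}
    (hS : HasFirstOrderTerm S T) (i : φ → ℂ) {t : κ → ℂ} (ht : star t ⬝ᵥ t = 1) :
    (fun α : ℝ => orthProb (S α) i t
      - (∑ f, opVariance (pureState t) (restrictOp T i f)) * α ^ 2) =O[𝓝 0]
      (fun α : ℝ => α ^ 3) := by
  choose e he h using fun f => exists_orthProbToMixed_expansion hS i f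
  have : (fun α : ℝ => orthProb (S α) i t
      - (∑ f, opVariance (pureState t) (restrictOp T i f)) * α ^ 2)
      = fun α => ∑ f, (orthProbTo (S α) i f t
        - α ^ 2 * opVariance (pureState t) (restrictOp T i f)) := by
    funext α
    rw [orthProb, Finset.sum_sub_distrib, ← Finset.mul_sum, mul_comm]
  rw [this]
  refine IsBigO.fun_sum fun f _ => IsBigO.trans (IsBigO.of_bound 1
    (Filter.Eventually.of_forall fun α => ?_)) (he f)
  rw [← orthProbToMixed_pureState, one_mul]
  exact (h f α _ (isDensity_pureState ht)).trans (le_abs_self _)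

theorem maxOrthProb_isBigO [Nonempty κ] [DecidableEq φ] {S : ℝ → Matrix (φ × κ) (φ × κ) ℂ}
    {T : Matrix (φ × κ) (φ × κ) ℂ} (hS : HasFirstOrderTerm S T) (i : φ → ℂ) :
    (fun α : ℝ => maxOrthProb (S α) i - maxVariance T i * α ^ 2) =O[𝓝 0]
      (fun α : ℝ => α ^ 3) := by
  choose e he h using fun f => exists_orthProbToMixed_expansion hS i f
  refine IsBigO.trans (IsBigO.of_bound 1 (Filter.Eventually.of_forall fun α => ?_))
    (IsBigO.fun_sum fun f (_ : f ∈ Finset.univ) => he f)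
  obtain ⟨t, ht⟩ := exists_unit_vector (κ := κ)
  rw [one_mul, mul_comm, maxOrthProb, maxVariance]
  refine (abs_sSup_sub_le (sq_nonneg α) ⟨_, isDensity_pureState ht⟩
    (fun ρ hρ => hρ.sum_opVariance_le_maxVariance T i) (e := ∑ f, e f α) ?_).trans (le_abs_self _)
  intro ρ hρ
  rw [Finset.mul_sum, ← Finset.sum_sub_distrib]
  exact (Finset.abs_sum_le_sum_abs _ _).trans (Finset.sum_le_sum fun f _ => h f α ρ hρ)

theorem sum_maxOrthProbTo_isBigO [Nonempty κ] [DecidableEq φ] {S : ℝ → Matrix (φ × κ) (φ × κ) ℂ}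
    {T : Matrix (φ × κ) (φ × κ) ℂ} (hS : HasFirstOrderTerm S T) (i : φ → ℂ) :
    (fun α : ℝ => (∑ f, maxOrthProbTo (S α) i f) - (∑ f, maxVarianceTo T i f) * α ^ 2) =O[𝓝 0]
      (fun α : ℝ => α ^ 3) := by
  simp only [Finset.sum_mul, ← Finset.sum_sub_distrib]
  refine IsBigO.fun_sum fun f _ => ?_
  obtain ⟨e, he, h⟩ := exists_orthProbToMixed_expansion hS i f
  refine IsBigO.trans (IsBigO.of_bound 1 (Filter.Eventually.of_forall fun α => ?_)) he
  rw [one_mul, mul_comm, maxOrthProbTo, maxVarianceTo]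
  refine (abs_sSup_sub_le (sq_nonneg α) exists_unit_vector
    (fun t ht => (isDensity_pureState ht).opVariance_le _) (e := e α) ?_).trans (le_abs_self _)
  intro t ht
  rw [← orthProbToMixed_pureState]
  exact h α _ (isDensity_pureState ht)

end Asymptotics

/-! ### Marginals of a vector state on a represented matrix algebra -/

section Marginals

variable {E : Type*} [NormedAddCommGroup E] [InnerProductSpace ℂ E] [CompleteSpace E]
  {κ : Type*} [Fintype κ] [DecidableEq κ]

/-- The (unnormalized) state induced by the vector `x` on a subsystem with observables `π G`. -/
def marginal (π : Matrix κ κ ℂ →⋆ₐ[ℂ] (E →L[ℂ] E)) (x : E) : Matrix κ κ ℂ :=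
  fun a b => inner ℂ x (π (Matrix.single b a 1) x)

theorem trace_marginal_mul (π : Matrix κ κ ℂ →⋆ₐ[ℂ] (E →L[ℂ] E)) (x : E) (G : Matrix κ κ ℂ) :
    (marginal π x * G).trace = inner ℂ x (π G x) := by
  have hG : G = ∑ b, ∑ a, G b a • Matrix.single b a (1 : ℂ) := by
    conv_lhs => rw [matrix_eq_sum_single G]
    simp
  conv_rhs => rw [hG]
  simp only [map_sum, map_smul, _root_.sum_apply, _root_.smul_apply, inner_sum, inner_smul_right]
  rw [Finset.sum_comm]
  simp only [trace, diag_apply, mul_apply, marginal]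
  exact Finset.sum_congr rfl fun a _ => Finset.sum_congr rfl fun b _ => mul_comm _ _

theorem posSemidef_marginal (π : Matrix κ κ ℂ →⋆ₐ[ℂ] (E →L[ℂ] E)) (x : E) :
    (marginal π x).PosSemidef := by
  rw [posSemidef_iff_dotProduct_mulVec]
  constructor
  · ext a b
    rw [conjTranspose_apply, marginal, marginal, inner_starAlgHom_apply, conjTranspose_single,
      star_one, ← starRingEnd_apply, inner_conj_symm]
  · intro v
    rcases isEmpty_or_nonempty κ with h | ⟨⟨c⟩⟩
    · simp [dotProduct]
    have h1 : star v ⬝ᵥ (marginal π x *ᵥ v) = (marginal π x * vecMulVec v (star v)).trace := by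
      rw [mul_vecMulVec, trace_vecMulVec, dotProduct_comm]
    -- Writing |v⟩⟨v| as X†X with X = |c⟩⟨v| turns the quadratic form into a squared norm, with no
    -- normalization of `v`.
    have h2 : vecMulVec v (star v) = (vecMulVec (Pi.single c 1) (star v))ᴴ
        * vecMulVec (Pi.single c 1) (star v) := by
      rw [conjTranspose_vecMulVec, star_star, ketBra_mul_ketBra]
      simp
    rw [h1, trace_marginal_mul, h2, ← starAlgHom_mul_apply, inner_starAlgHom_apply,
      conjTranspose_conjTranspose, inner_self_eq_norm_sq_to_K]
    simp

theorem isDensity_marginal (π : Matrix κ κ ℂ →⋆ₐ[ℂ] (E →L[ℂ] E)) {x : E} (hx : ‖x‖ = 1) :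
    IsDensity (marginal π x) := by
  refine ⟨posSemidef_marginal π x, ?_⟩
  have := trace_marginal_mul π x 1
  rw [mul_one, map_one, one_apply_eq_self, inner_self_eq_norm_sq_to_K, hx] at this
  simpa using this

/-- The mixture of `x` and `y` induces a density matrix on the subsystem after division by ‖x‖² +
‖y‖², so the supremum over mixed subsystem states controls vectors of the whole space. -/
theorem varianceBound_of_forall_density (π : Matrix κ κ ℂ →⋆ₐ[ℂ] (E →L[ℂ] E)) {φ : Type*}
    [Fintype φ] {A : φ → Matrix κ κ ℂ} {M : ℝ}
    (h : ∀ σ, IsDensity σ → ∑ f, opVariance σ (A f) ≤ M) :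
    VarianceBound (fun f => π (A f)) M := by
  intro x y
  by_cases hxy : ‖x‖ ^ 2 + ‖y‖ ^ 2 = 0
  · have hx : x = 0 := by
      have : ‖x‖ ^ 2 = 0 := by nlinarith [sq_nonneg ‖x‖, sq_nonneg ‖y‖]
      simpa using this
    have hy : y = 0 := by
      have : ‖y‖ ^ 2 = 0 := by nlinarith [sq_nonneg ‖x‖, sq_nonneg ‖y‖]
      simpa using this
    simp [hx, hy]
  set n := ‖x‖ ^ 2 + ‖y‖ ^ 2 with hn
  have hn0 : 0 < n := lt_of_le_of_ne (by positivity) (Ne.symm hxy)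
  set σ : Matrix κ κ ℂ := ((n⁻¹ : ℝ) : ℂ) • (marginal π x + marginal π y) with hσ
  have htr : ∀ G, (σ * G).trace
      = ((n⁻¹ : ℝ) : ℂ) * (inner ℂ x (π G x) + inner ℂ y (π G y)) := by
    intro G
    rw [hσ, smul_mul, trace_smul, add_mul, trace_add, trace_marginal_mul, trace_marginal_mul,
      smul_eq_mul]
  have hd : IsDensity σ := by
    refine ⟨((posSemidef_marginal π x).add (posSemidef_marginal π y)).smul ?_, ?_⟩
    · exact_mod_cast (inv_pos.2 hn0).le
    · have := htr 1
      rw [mul_one, map_one, one_apply_eq_self, one_apply_eq_self, inner_self_eq_norm_sq_to_K,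
        inner_self_eq_norm_sq_to_K] at this
      rw [this]
      have h1 : n⁻¹ * n = 1 := inv_mul_cancel₀ hn0.ne'
      rw [hn] at h1
      have h2 := congrArg (fun r : ℝ => (r : ℂ)) h1
      simpa [hn] using h2
  have hsq : ∀ (G : Matrix κ κ ℂ) (z : E),
      inner ℂ z (π (Gᴴ * G) z) = ((‖π G z‖ ^ 2 : ℝ) : ℂ) := by
    intro G z
    rw [← starAlgHom_mul_apply, inner_starAlgHom_apply, conjTranspose_conjTranspose,
      inner_self_eq_norm_sq_to_K]
    simp
  have hterm : ∀ f, (n * (‖π (A f) x‖ ^ 2 + ‖π (A f) y‖ ^ 2)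
      - ‖inner ℂ x (π (A f) x) + inner ℂ y (π (A f) y)‖ ^ 2) = n ^ 2 * opVariance σ (A f) := by
    intro f
    rw [opVariance, htr, htr, hsq, hsq, ← Complex.ofReal_add, ← Complex.ofReal_mul,
      Complex.ofReal_re, norm_mul, Complex.norm_real, Real.norm_of_nonneg (inv_pos.2 hn0).le]
    field_simp
  simp only [hterm, ← Finset.mul_sum]
  rw [mul_comm M]
  exact mul_le_mul_of_nonneg_left (h σ hd) (by positivity)

end Marginals

/-! ### The tensor factors as commuting matrix algebras -/

section Sites

variable {N : ℕ} {ι : Fin N → Type*} [∀ k, Fintype (ι k)] [∀ k, DecidableEq (ι k)]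

theorem sum_ite_agree_off {M : Type*} [AddCommMonoid M] (k : Fin N) (x : ∀ l, ι l)
    (F : (∀ l, ι l) → M) :
    ∑ y, (if ∀ l, l ≠ k → x l = y l then F y else 0) = ∑ b, F (Function.update x k b) := by
  rw [← Finset.sum_filter]
  refine Finset.sum_nbij' (fun y => y k) (fun b => Function.update x k b) ?_ ?_ ?_ ?_ ?_
  · intro y _; simp
  · intro b _
    simp only [Finset.mem_filter, Finset.mem_univ, true_and]
    intro l hl
    rw [Function.update_of_ne hl]
  · intro y hy
    simp only [Finset.mem_filter, Finset.mem_univ, true_and] at hy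
    funext l
    by_cases h : l = k
    · subst h; simp
    · rw [Function.update_of_ne h, hy l h]
  · intro b _; simp
  · intro y hy
    simp only [Finset.mem_filter, Finset.mem_univ, true_and] at hy
    congr 1
    funext l
    by_cases h : l = k
    · subst h; simp
    · rw [Function.update_of_ne h, hy l h]

/-- An operator on the `k`-th factor, extended by the identity to the other factors. -/
def siteMatrix (k : Fin N) (G : Matrix (ι k) (ι k) ℂ) : Matrix (∀ l, ι l) (∀ l, ι l) ℂ :=
  fun x y => if ∀ l, l ≠ k → x l = y l then G (x k) (y k) else 0

theorem siteMatrix_mul_apply (k : Fin N) (G : Matrix (ι k) (ι k) ℂ)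
    (B : Matrix (∀ l, ι l) (∀ l, ι l) ℂ) (x y : ∀ l, ι l) :
    (siteMatrix k G * B) x y = ∑ b, G (x k) b * B (Function.update x k b) y := by
  simp only [mul_apply, siteMatrix, ite_mul, zero_mul]
  rw [sum_ite_agree_off k x fun z => G (x k) (z k) * B z y]
  simp

/-- The embedding of the operators on the `k`-th factor. -/
def siteHom (k : Fin N) :
    Matrix (ι k) (ι k) ℂ →⋆ₐ[ℂ] Matrix (∀ l, ι l) (∀ l, ι l) ℂ where
  toFun := siteMatrix k
  map_one' := by
    ext x y
    simp only [siteMatrix, one_apply]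
    by_cases h : x = y
    · subst h; simp
    · rw [if_neg h]
      split_ifs with h1 h2
      · exact absurd (funext fun l => if hl : l = k then by subst hl; exact h2 else h1 l hl) h
      · rfl
      · rfl
  map_mul' F G := by
    ext x y
    rw [siteMatrix_mul_apply]
    simp only [siteMatrix, mul_apply]
    have : ∀ b, (∀ l, l ≠ k → Function.update x k b l = y l) ↔ ∀ l, l ≠ k → x l = y l :=
      fun b => forall₂_congr fun l hl => by rw [Function.update_of_ne hl]
    simp only [this, Function.update_self]
    split_ifs <;> simp
  map_zero' := by ext x y; simp [siteMatrix]
  map_add' F G := by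
    ext x y
    simp only [siteMatrix, Matrix.add_apply]
    split_ifs <;> simp
  commutes' r := by
    ext x y
    simp only [siteMatrix, algebraMap_matrix_apply]
    by_cases h : x = y
    · subst h; simp
    · rw [if_neg h]
      split_ifs with h1 h2
      · exact absurd (funext fun l => if hl : l = k then by subst hl; exact h2 else h1 l hl) h
      · rfl
      · rfl
  map_star' G := by
    ext x y
    simp only [siteMatrix, star_apply]
    simp only [eq_comm (a := x _)]
    split_ifs <;> simp

theorem siteHom_apply (k : Fin N) (G : Matrix (ι k) (ι k) ℂ) (x y : ∀ l, ι l) :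
    siteHom k G x y = if ∀ l, l ≠ k → x l = y l then G (x k) (y k) else 0 := rfl

theorem siteHom_mul_siteHom_apply {k l : Fin N} (hkl : k ≠ l) (F : Matrix (ι k) (ι k) ℂ)
    (G : Matrix (ι l) (ι l) ℂ) (x y : ∀ l, ι l) :
    (siteHom k F * siteHom l G) x y
      = if ∀ j, j ≠ k → j ≠ l → x j = y j then F (x k) (y k) * G (x l) (y l) else 0 := by
  change (siteMatrix k F * siteMatrix l G) x y = _
  rw [siteMatrix_mul_apply, Finset.sum_eq_single (y k)]
  · have : (∀ j, j ≠ l → Function.update x k (y k) j = y j) ↔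
        ∀ j, j ≠ k → j ≠ l → x j = y j := by
      refine forall_congr' fun j => ?_
      by_cases h : j = k
      · subst h; simp
      · simp [h]
    simp only [siteMatrix, this, Function.update_of_ne hkl.symm]
    split_ifs <;> simp
  · intro b _ hb
    rw [siteMatrix, if_neg, mul_zero]
    intro h
    exact hb (by simpa using h k hkl)
  · simp

theorem commute_siteHom {k l : Fin N} (hkl : k ≠ l) (F : Matrix (ι k) (ι k) ℂ)
    (G : Matrix (ι l) (ι l) ℂ) : Commute (siteHom k F) (siteHom l G) := by
  ext x y
  rw [siteHom_mul_siteHom_apply hkl, siteHom_mul_siteHom_apply hkl.symm, mul_comm]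
  congr 1
  exact propext (forall_congr' fun j => ⟨fun h h1 h2 => h h2 h1, fun h h1 h2 => h h2 h1⟩)

theorem restrictOp_sum_siteOp {φ : Type*} [Fintype φ]
    (T : ∀ k, Matrix (φ × ι k) (φ × ι k) ℂ) (i : φ → ℂ) (f : φ) :
    restrictOp (∑ k, siteOp k (T k)) i f = ∑ k, siteHom k (restrictOp (T k) i f) := by
  ext x y
  simp only [restrictOp, Matrix.sum_apply, siteHom_apply, Finset.sum_mul]
  rw [Finset.sum_comm]
  refine Finset.sum_congr rfl fun k _ => ?_
  simp only [siteOp]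
  split_ifs <;> simp

/-- The observables of the `k`-th factor as operators on Euclidean space. -/
def siteObs (k : Fin N) : Matrix (ι k) (ι k) ℂ →⋆ₐ[ℂ]
    (EuclideanSpace ℂ (∀ l, ι l) →L[ℂ] EuclideanSpace ℂ (∀ l, ι l)) :=
  euclideanOp.comp (siteHom k)

theorem siteObs_apply (k : Fin N) (G : Matrix (ι k) (ι k) ℂ) :
    siteObs k G = euclideanOp (siteHom k G) := rfl

theorem commute_siteObs {k l : Fin N} (hkl : k ≠ l) (F : Matrix (ι k) (ι k) ℂ)
    (G : Matrix (ι l) (ι l) ℂ) : Commute (siteObs k F) (siteObs l G) :=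
  (commute_siteHom hkl F G).map euclideanOp

/-- Connects the concrete partial trace with the representation-theoretic marginal used in the
covariance estimates. -/
theorem reducedState_eq_marginal (k : Fin N) (x : EuclideanSpace ℂ (∀ l, ι l)) :
    reducedState k (pureState x.ofLp) = marginal (siteObs k) x := by
  ext a b
  rw [marginal, siteObs_apply, inner_euclideanOp]
  simp only [dotProduct, mulVec, Finset.mul_sum]
  rw [Finset.sum_comm, reducedState]
  refine Finset.sum_congr rfl fun y _ => ?_
  have h1 : ∀ z : ∀ l, ι l, star x.ofLp z * (siteHom k (Matrix.single b a 1) z y * x.ofLp y)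
      = if ∀ l, l ≠ k → y l = z l then
          star x.ofLp z * (Matrix.single b a (1 : ℂ) (z k) (y k) * x.ofLp y) else 0 := by
    intro z
    rw [siteHom_apply]
    simp only [eq_comm (a := z _)]
    split_ifs <;> simp
  rw [Finset.sum_congr rfl fun z _ => h1 z, sum_ite_agree_off k y fun z =>
    star x.ofLp z * (Matrix.single b a (1 : ℂ) (z k) (y k) * x.ofLp y)]
  simp only [Function.update_self, Matrix.single_apply, pureState, vecMulVec_apply, Pi.star_apply]
  rw [Finset.sum_eq_single b]
  · by_cases h : y k = a
    · simp [h, mul_comm]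
    · simp [h, Ne.symm h]
  · intro c _ hc
    simp [Ne.symm hc]
  · simp

end Sites

/-! ### Summing the covariances -/

section Main

variable {N : ℕ}

/-- By symmetry the smaller of s_k and s_l may be used. With 2√(m_k m_l) ≤ m_k + m_l this gives
C_{kl} ≤ m_k √s_l + m_l √s_k, whose full double sum factorizes; finally Σ √s_k ≤ N √(avg s) by
Cauchy-Schwarz. -/
theorem sum_le_avg_mul (hN : 0 < N) {C : Fin N → Fin N → ℝ} {m s : Fin N → ℝ}
    (hm : ∀ k, 0 ≤ m k) (hs : ∀ k, 0 ≤ s k) (hsymm : ∀ k l, C k l = C l k)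
    (hdiag : ∀ k, C k k ≤ m k)
    (hoff : ∀ k l, k ≠ l → C k l ≤ 2 * √(s k) * (√(m k) * √(m l))) :
    ∑ k, ∑ l, C k l ≤ avg m * (N + 2 * (N : ℝ) ^ 2 * √(avg s)) := by
  have hN' : (0 : ℝ) < N := by exact_mod_cast hN
  have hamgm : ∀ k l, 2 * (√(m k) * √(m l)) ≤ m k + m l := fun k l => by
    nlinarith [sq_nonneg (√(m k) - √(m l)), Real.sq_sqrt (hm k), Real.sq_sqrt (hm l)]
  have hpair : ∀ k l, k ≠ l → C k l ≤ m k * √(s l) + m l * √(s k) := by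
    intro k l hkl
    rcases le_total (√(s k)) (√(s l)) with h | h
    · calc C k l ≤ √(s k) * (2 * (√(m k) * √(m l))) := by linarith [hoff k l hkl]
        _ ≤ √(s k) * (m k + m l) := by gcongr; exact hamgm k l
        _ ≤ m k * √(s l) + m l * √(s k) := by nlinarith [hm k]
    · calc C k l ≤ √(s l) * (2 * (√(m k) * √(m l))) := by
            rw [hsymm]; linarith [hoff l k hkl.symm]
        _ ≤ √(s l) * (m k + m l) := by gcongr; exact hamgm k l
        _ ≤ m k * √(s l) + m l * √(s k) := by nlinarith [hm l]
  -- Adding the nonnegative off-diagonal bound on the diagonal too is what lets the double sum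
  -- factorize.
  have hall : ∀ k l, C k l ≤ (if k = l then m k else 0) + (m k * √(s l) + m l * √(s k)) := by
    intro k l
    split_ifs with h
    · subst h
      have := mul_nonneg (hm k) (Real.sqrt_nonneg (s k))
      linarith [hdiag k]
    · rw [zero_add]; exact hpair k l h
  have hsum : ∑ k, ∑ l, C k l ≤ ∑ k, m k + 2 * ((∑ k, m k) * ∑ k, √(s k)) := by
    refine (Finset.sum_le_sum fun k _ => Finset.sum_le_sum fun l _ => hall k l).trans (le_of_eq ?_)
    simp only [Finset.sum_add_distrib, Finset.sum_ite_eq, Finset.mem_univ, if_true]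
    rw [Finset.sum_mul_sum, two_mul]
    congr 2
    rw [Finset.sum_comm]
  have hS : ∑ k, √(s k) ≤ N * √(avg s) := by
    refine abs_le_of_sq_le_sq' ?_ (by positivity) |>.2
    have h := sq_sum_le_card_mul_sum_sq (s := Finset.univ) (f := fun k => √(s k))
    simp only [Finset.card_univ, Fintype.card_fin, Real.sq_sqrt (hs _)] at h
    have h0 : 0 ≤ avg s := div_nonneg (Finset.sum_nonneg fun k _ => hs k) hN'.le
    rw [mul_pow, Real.sq_sqrt h0, avg]
    refine h.trans (le_of_eq ?_)
    field_simp
  have hM : 0 ≤ ∑ k, m k := Finset.sum_nonneg fun k _ => hm k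
  have havg : avg m * N = ∑ k, m k := by rw [avg]; field_simp
  calc ∑ k, ∑ l, C k l ≤ ∑ k, m k + 2 * ((∑ k, m k) * (N * √(avg s))) := by
        refine hsum.trans ?_
        gcongr
    _ = _ := by rw [← havg]; ring

theorem re_vecCov_symm {E φ : Type*} [NormedAddCommGroup E] [InnerProductSpace ℂ E] [Fintype φ]
    (A B : φ → E →L[ℂ] E) (t : E) : (vecCov A B t).re = (vecCov B A t).re := by
  have : vecCov A B t = starRingEnd ℂ (vecCov B A t) := by
    simp only [vecCov, map_sum, map_sub, map_mul, inner_conj_symm]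
    exact Finset.sum_congr rfl fun f _ => by ring
  rw [this, Complex.conj_re]

variable {φ : Type*} [Fintype φ] {ι : Fin N → Type*} [∀ k, Fintype (ι k)]
  [∀ k, DecidableEq (ι k)]

theorem sum_opVariance_sum_siteHom (G : ∀ k, φ → Matrix (ι k) (ι k) ℂ)
    (x : EuclideanSpace ℂ (∀ l, ι l)) :
    ∑ f, opVariance (pureState x.ofLp) (∑ k, siteHom k (G k f))
      = ∑ k, ∑ l, (vecCov (fun f => siteObs k (G k f)) (fun f => siteObs l (G l f)) x).re := by
  have h1 : ∀ f, opVariance (pureState x.ofLp) (∑ k, siteHom k (G k f))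
      = ∑ k, ∑ l, (inner ℂ (siteObs k (G k f) x) (siteObs l (G l f) x)
        - inner ℂ (siteObs k (G k f) x) x * inner ℂ x (siteObs l (G l f) x)).re := by
    intro f
    rw [opVariance_pureState, map_sum, _root_.sum_apply]
    simp only [← siteObs_apply]
    set w := ∑ k, siteObs k (G k f) x with hw
    have e1 : ‖w‖ ^ 2 = (inner ℂ w w).re := by
      rw [inner_self_eq_norm_sq_to_K]; norm_cast
    have e2 : ‖(inner ℂ x w : ℂ)‖ ^ 2 = (inner ℂ w x * inner ℂ x w).re := by
      rw [← inner_conj_symm w x, Complex.conj_mul']; norm_cast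
    have e3 : inner ℂ w w
        = ∑ k, ∑ l, (inner ℂ (siteObs k (G k f) x) (siteObs l (G l f) x) : ℂ) := by
      rw [hw, sum_inner]
      exact Finset.sum_congr rfl fun k _ => inner_sum _ _ _
    rw [e1, e2, ← Complex.sub_re, e3, hw, sum_inner, inner_sum, Finset.sum_mul_sum]
    simp only [← Finset.sum_sub_distrib, Complex.re_sum]
  simp only [h1, vecCov, Complex.re_sum]
  rw [Finset.sum_comm]
  exact Finset.sum_congr rfl fun k _ => Finset.sum_comm

/-- The inequality for observables of commuting subsystems of an arbitrary Hilbert space. -/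
theorem sum_re_vecCov_le {E : Type*} [NormedAddCommGroup E] [InnerProductSpace ℂ E]
    [CompleteSpace E] (hN : 0 < N) (π : ∀ k, Matrix (ι k) (ι k) ℂ →⋆ₐ[ℂ] (E →L[ℂ] E))
    (hπ : ∀ k l, k ≠ l → ∀ F G, Commute (π k F) (π l G)) {x : E} (hx : ‖x‖ = 1)
    (i : φ → ℂ) (T : ∀ k, Matrix (φ × ι k) (φ × ι k) ℂ) :
    ∑ k, ∑ l, (vecCov (fun f => π k (restrictOp (T k) i f))
        (fun f => π l (restrictOp (T l) i f)) x).re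
      ≤ avg (fun k => maxVariance (T k) i) * (N + 2 * (N : ℝ) ^ 2 *
        √(avg fun k => vonNeumannEntropy (marginal (π k) x))) := by
  have hbound : ∀ k, VarianceBound (fun f => π k (restrictOp (T k) i f))
      (maxVariance (T k) i) := fun k =>
    varianceBound_of_forall_density _ fun σ hσ => hσ.sum_opVariance_le_maxVariance (T k) i
  have hρ : ∀ k, IsDensity (marginal (π k) x) := fun k => isDensity_marginal _ hx
  have hm : ∀ k, 0 ≤ maxVariance (T k) i := fun k => (hbound k).nonneg hx
  refine sum_le_avg_mul hN hm (fun k => (hρ k).vonNeumannEntropy_nonneg)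
    (fun k l => re_vecCov_symm _ _ x) ?_ ?_
  · intro k
    refine (Complex.re_le_norm _).trans ((norm_vecCov_le (hbound k) (hbound k) hx).trans ?_)
    rw [Real.mul_self_sqrt (hm k)]
  · intro k l hkl
    exact (Complex.re_le_norm _).trans (norm_vecCov_le_entropy (π k) hx (hρ k)
      (fun G => (trace_marginal_mul (π k) x G).symm)
      (fun f G => hπ k l hkl G _) (hbound k) (hbound l))

/-- The inequality between the leading coefficients. -/
theorem sum_opVariance_le_avg_maxVariance (hN : 0 < N) {t : (∀ k, ι k) → ℂ}
    (ht : star t ⬝ᵥ t = 1) (i : φ → ℂ) (T : ∀ k, Matrix (φ × ι k) (φ × ι k) ℂ) :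
    ∑ f, opVariance (pureState t) (restrictOp (∑ k, siteOp k (T k)) i f)
      ≤ avg (fun k => maxVariance (T k) i) * (N + 2 * (N : ℝ) ^ 2 *
        √(avg fun k => vonNeumannEntropy (reducedState k (pureState t)))) := by
  have hx : ‖(WithLp.toLp 2 t : EuclideanSpace ℂ (∀ l, ι l))‖ = 1 := by
    have h := (norm_sq_eq_one_iff (WithLp.toLp 2 t : EuclideanSpace ℂ (∀ l, ι l))).2 ht
    nlinarith [norm_nonneg (WithLp.toLp 2 t : EuclideanSpace ℂ (∀ l, ι l))]
  have h := sum_re_vecCov_le hN siteObs (fun k l hkl => commute_siteObs hkl) hx i T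
  rw [← sum_opVariance_sum_siteHom (fun k f => restrictOp (T k) i f)] at h
  simp only [← reducedState_eq_marginal, ← restrictOp_sum_siteOp] at h
  exact h

end Main

end

theorem mainTheorem6 {N : ℕ} (hN : 0 < N)
    {φ : Type*} [Fintype φ] [DecidableEq φ]
    {ι : Fin N → Type*} [∀ k, Fintype (ι k)] [∀ k, DecidableEq (ι k)]
    (i : φ → ℂ) (hi : star i ⬝ᵥ i = 1)
    (t : (∀ k, ι k) → ℂ) (ht : star t ⬝ᵥ t = 1)
    (T : ∀ k, Matrix (φ × ι k) (φ × ι k) ℂ)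
    (S : ℝ → Matrix (φ × ∀ k, ι k) (φ × ∀ k, ι k) ℂ)
    (hS : HasFirstOrderTerm S (∑ k, siteOp k (T k)))
    (Ssite : ∀ k, ℝ → Matrix (φ × ι k) (φ × ι k) ℂ)
    (hSsite : ∀ k, HasFirstOrderTerm (Ssite k) (T k)) :
    ∃ (c : ℝ) (m m' : Fin N → ℝ),
      (fun α : ℝ => orthProb (S α) i t - c * α ^ 2) =O[𝓝 0] (fun α : ℝ => α ^ 3) ∧
      (∀ k, (fun α : ℝ => maxOrthProb (Ssite k α) i - m k * α ^ 2)
        =O[𝓝 0] (fun α : ℝ => α ^ 3)) ∧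
      (∀ k, (fun α : ℝ => (∑ f, maxOrthProbTo (Ssite k α) i f) - m' k * α ^ 2)
        =O[𝓝 0] (fun α : ℝ => α ^ 3)) ∧
      c ≤ avg m * (N + 2 * (N : ℝ) ^ 2 *
        √(avg fun k => vonNeumannEntropy (reducedState k (pureState t)))) ∧
      c ≤ avg m' * (N + 2 * (N : ℝ) ^ 2 *
        √(avg fun k => vonNeumannEntropy (reducedState k (pureState t)))) := by
  -- The normalization of `t` rules out an empty basis, so every factor has states and the suprema
  -- run over nonempty sets.
  have hX : Nonempty (∀ k, ι k) := by
    by_contra h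
    rw [not_nonempty_iff] at h
    simp [dotProduct] at ht
  have hne : ∀ k, Nonempty (ι k) := fun k => hX.map fun x => x k
  have hmain := sum_opVariance_le_avg_maxVariance hN ht i T
  refine ⟨_, fun k => maxVariance (T k) i, fun k => ∑ f, maxVarianceTo (T k) i f,
    orthProb_isBigO hS i ht, fun k => maxOrthProb_isBigO (hSsite k) i,
    fun k => sum_maxOrthProbTo_isBigO (hSsite k) i, hmain, hmain.trans ?_⟩
  refine mul_le_mul_of_nonneg_right ?_ (by positivity)
  exact div_le_div_of_nonneg_right
    (Finset.sum_le_sum fun k _ => maxVariance_le_sum_maxVarianceTo (T k) i) (Nat.cast_nonneg N)
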